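/- Let $n\ge 1$. Let $\mathcal{P}_n$ be the partition monoid: its elements are the equivalence relations on $\{1,\dots,n\}\cup\{1',\dots,n'\}$ (the classes are called blocks), drawn as diagrams with upper row $1,\dots,n$ and lower row $1',\dots,n'$. The product $\alpha\beta$ is obtained by stacking $\alpha$ on top of $\beta$, identifying the lower row of $\alpha$ with the upper row of $\beta$, and restricting connectedness in the resulting graph to the two outer rows; the identity $1$ has blocks $\{k,k'\}$. The rank of $\alpha$ is the number of its blocks that meet both rows, and $\alpha^*$ is the reflection of $\alpha$ in a horizontal axis. The Jones monoid $\mathcal{J}_n\subseteq\mathcal{P}_n$ consists of the partitions all of whose blocks have size $2$ and which can be drawn without crossings. For $1\le i\le n-1$ let $\tau_i\in\mathcal{J}_n$ have blocks $\{i,i+1\}$, $\{i',(i+1)'\}$ and $\{k,k'\}$ for all other $k$. For $1\le i\le n-2$ let $\lambda_i$ have blocks $\{i,i+1\}$, $\{i+2,i'\}$, $\{(i+1)',(i+2)'\}$ and $\{k,k'\}$ for all other $k$, and let $\rho_i=\lambda_i^*$. Let $E_n$ be the set of idempotents of $\mathcal{J}_n$ of rank $n-2$. (In fact $E_n=\{\tau_1,\dots,\tau_{n-1}\}\cup\{\lambda_1,\dots,\lambda_{n-2}\}\cup\{\rho_1,\dots,\rho_{n-2}\}$.)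 For $F\subseteq E_n$ let $\Xi_n(F)$ be the following digraph with red and blue arcs. Its vertices are the projections of rank $n-2$ in $\mathcal{J}_n$, i.e. the $p\in E_n$ with $p^*=p$ (these are $\tau_1,\dots,\tau_{n-1}$). There is a blue arc $p\to q$ whenever $pq$ has rank $n-2$ (for $\tau_i\to\tau_j$ this means $|i-j|\le 1$). There is a red arc $\tau_i\to\tau_i$ if $\tau_i\in F$, a red arc $\tau_i\to\tau_{i+1}$ if $\lambda_i\in F$, and a red arc $\tau_{i+1}\to\tau_i$ if $\rho_i\in F$. An RBR-alternating circuit based at a vertex $v$ is a directed path from $v$ to $v$ (vertices and arcs may be repeated) whose arcs alternate in colour between red and blue and whose first and last arcs are red; a single red loop is an example. A red circuit is a directed closed path with at least one arc, all of whose arcs are red. **Theorem.** For every $F\subseteq E_n$ the following are equivalent: (i) $\mathcal{J}_n\setminus\{1\}=\langle F\rangle$, the semigroup generated by $F$; (ii) each vertex of $\Xi_n(F)$ is the base point of an RBR-alternating circuit; (iii) each vertex of $\Xi_n(F)$ is contained in a red circuit. Moreover, the number $f_n$ of subsets $F\subseteq E_n$ with these properties satisfies $$f_2=1,\qquad f_3=7,\qquad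 f_n=5f_{n-1}+6f_{n-2}\quad\text{for all } n\ge 4.$$ -/

import Mathlib

/-- The vertices of a diagram on `n` strings: the upper row `1, …, n` (`Sum.inl`) and
the lower row `1', …, n'` (`Sum.inr`).  Positions are numbered from `0`. -/
abbrev DiagramVertex (n : ℕ) : Type := Fin n ⊕ Fin n

/-- An element of the partition monoid `𝒫ₙ`: an equivalence relation on the `2n` vertices. -/
@[ext]
structure PartitionDiagram (n : ℕ) where
  /-- the equivalence relation whose classes are the blocks -/
  rel : Setoid (DiagramVertex n)

namespace PartitionDiagram

variable {n : ℕ}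

/-- The partition represented by a graph: its blocks are the connected components. -/
def ofGraph (edge : DiagramVertex n → DiagramVertex n → Prop) : PartitionDiagram n :=
  ⟨Relation.EqvGen.setoid edge⟩

/-- Edges of the identity diagram: `k — k'` for all `k`. -/
def oneEdge : DiagramVertex n → DiagramVertex n → Prop
  | .inl a, .inr b => a = b
  | _, _ => False

instance : One (PartitionDiagram n) := ⟨ofGraph oneEdge⟩

/-- The three rows of the stacked diagrams `α` (above) and `β` (below). -/
inductive StackVertex (n : ℕ) : Type
  | top (k : Fin n)
  | mid (k : Fin n)
  | bot (k : Fin n)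

/-- Placement of the vertices of the upper diagram in the stack. -/
def upperPlace : DiagramVertex n → StackVertex n
  | .inl k => .top k
  | .inr k => .mid k

/-- Placement of the vertices of the lower diagram in the stack. -/
def lowerPlace : DiagramVertex n → StackVertex n
  | .inl k => .mid k
  | .inr k => .bot k

/-- Placement of the vertices of the product: the outer two rows of the stack. -/
def outerPlace : DiagramVertex n → StackVertex n
  | .inl k => .top k
  | .inr k => .bot k

/-- The graph got by stacking `α` on `β`, identifying the lower row of `α` with the
upper row of `β`. -/
inductive StackEdge (α β : PartitionDiagram n) : StackVertex n → StackVertex n → Prop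
  | upper {x y : DiagramVertex n} (h : α.rel x y) :
      StackEdge α β (upperPlace x) (upperPlace y)
  | lower {x y : DiagramVertex n} (h : β.rel x y) :
      StackEdge α β (lowerPlace x) (lowerPlace y)

/-- The product `αβ`: connectedness in the stacked graph, restricted to the outer rows. -/
instance : Mul (PartitionDiagram n) :=
  ⟨fun α β => ⟨Setoid.comap outerPlace (Relation.EqvGen.setoid (StackEdge α β))⟩⟩

/-- The involution `α ↦ α*`: reflection in a horizontal axis. -/
instance : Star (PartitionDiagram n) := ⟨fun α => ⟨Setoid.comap Sum.swap α.rel⟩⟩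

/-- The rank: the number of blocks that meet both rows. -/
noncomputable def rank (α : PartitionDiagram n) : ℕ :=
  {B ∈ α.rel.classes | (∃ i, Sum.inl i ∈ B) ∧ ∃ j, Sum.inr j ∈ B}.ncard

/-- Every block has exactly two elements. -/
def IsBrauer (α : PartitionDiagram n) : Prop := ∀ B ∈ α.rel.classes, B.ncard = 2

/-- Position of a vertex in the order `1, 2, …, n, n', …, 2', 1'` around the boundary
of the diagram. -/
def boundaryPos : DiagramVertex n → ℕ
  | .inl k => k
  | .inr k => 2 * n - 1 - k

/-- The partition can be drawn without crossings inside the rectangle bounded by the two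
rows: two blocks never interleave along the boundary. -/
def IsPlanar (α : PartitionDiagram n) : Prop :=
  ∀ a b c d : DiagramVertex n, boundaryPos a < boundaryPos b → boundaryPos b < boundaryPos c →
    boundaryPos c < boundaryPos d → α.rel a c → α.rel b d → α.rel a b

/-- The Jones monoid `𝒥ₙ`, as a subset of the partition monoid. -/
def jones (n : ℕ) : Set (PartitionDiagram n) := {α | IsBrauer α ∧ IsPlanar α}

/-- The idempotents of rank `n - 2` in `𝒥ₙ`. -/
def subtopIdempotents (n : ℕ) : Set (PartitionDiagram n) :=
  {α | α ∈ jones n ∧ IsIdempotentElem α ∧ α.rank + 2 = n}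

/-- Edges of `τᵢ` (with `i` counted from `0`). -/
def tauEdge (i : ℕ) : DiagramVertex n → DiagramVertex n → Prop
  | .inl a, .inl b => a.val = i ∧ b.val = i + 1
  | .inr a, .inr b => a.val = i ∧ b.val = i + 1
  | .inl a, .inr b => a = b ∧ a.val ≠ i ∧ a.val ≠ i + 1
  | .inr _, .inl _ => False

/-- `τᵢ` has blocks `{i, i+1}`, `{i', (i+1)'}` and `{k, k'}` for all other `k`. -/
def tau (n i : ℕ) : PartitionDiagram n := ofGraph (tauEdge i)

/-- Edges of `λᵢ` (with `i` counted from `0`). -/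
def lamEdge (i : ℕ) : DiagramVertex n → DiagramVertex n → Prop
  | .inl a, .inl b => a.val = i ∧ b.val = i + 1
  | .inr a, .inr b => a.val = i + 1 ∧ b.val = i + 2
  | .inl a, .inr b => (a.val = i + 2 ∧ b.val = i) ∨
      (a = b ∧ a.val ≠ i ∧ a.val ≠ i + 1 ∧ a.val ≠ i + 2)
  | .inr _, .inl _ => False

/-- `λᵢ` has blocks `{i, i+1}`, `{i+2, i'}`, `{(i+1)', (i+2)'}` and `{k, k'}` for all
other `k`. -/
def lam (n i : ℕ) : PartitionDiagram n := ofGraph (lamEdge i)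

/-- Edges of `ρᵢ` (with `i` counted from `0`). -/
def rhoEdge (i : ℕ) : DiagramVertex n → DiagramVertex n → Prop
  | .inl a, .inl b => a.val = i + 1 ∧ b.val = i + 2
  | .inr a, .inr b => a.val = i ∧ b.val = i + 1
  | .inl a, .inr b => (a.val = i ∧ b.val = i + 2) ∨
      (a = b ∧ a.val ≠ i ∧ a.val ≠ i + 1 ∧ a.val ≠ i + 2)
  | .inr _, .inl _ => False

/-- `ρᵢ` has blocks `{i+1, i+2}`, `{i, (i+2)'}`, `{i', (i+1)'}` and `{k, k'}` for all
other `k`. -/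
def rho (n i : ℕ) : PartitionDiagram n := ofGraph (rhoEdge i)

/-- The set `F` generates the singular part of `𝒥ₙ` as a semigroup: `𝒥ₙ ∖ {1} = ⟨F⟩`. -/
def GeneratesSingularJones (F : Set (PartitionDiagram n)) : Prop :=
  (Subsemigroup.closure F : Set (PartitionDiagram n)) = jones n \ {1}

end PartitionDiagram

/-- A digraph (loops allowed) with red and blue arcs; there may be both a red and a blue
arc from one vertex to another. -/
structure TwoColouredDigraph (V : Type*) where
  /-- the red arcs -/
  red : V → V → Prop
  /-- the blue arcs -/
  blue : V → V → Prop

namespace TwoColouredDigraph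

variable {V : Type*}

/-- There is a directed path from `u` to `v` whose arcs are alternately red and blue and
whose first and last arcs are red. -/
inductive RBRPath (G : TwoColouredDigraph V) : V → V → Prop
  | single {u v : V} (h : G.red u v) : RBRPath G u v
  | cons {u v w x : V} (h : G.red u v) (h' : G.blue v w) (p : RBRPath G w x) : RBRPath G u x

/-- `v` is the base point of an RBR-alternating circuit. -/
def IsRBRBase (G : TwoColouredDigraph V) (v : V) : Prop := G.RBRPath v v

/-- `v` is one of the vertices of a directed circuit all of whose arcs are red. -/
def OnRedCircuit (G : TwoColouredDigraph V) (v : V) : Prop :=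
  ∃ c : Cycle V, v ∈ c ∧ c.Chain G.red

end TwoColouredDigraph

namespace PartitionDiagram

variable {n : ℕ}

/-- The vertices of the graph `Ξₙ`: the projections of rank `n - 2` in `𝒥ₙ`. -/
def XiVertex (n : ℕ) : Type := {p : PartitionDiagram n // p ∈ subtopIdempotents n ∧ star p = p}

/-- The two-coloured digraph `Ξₙ(F)`.  Its blue arcs are those of the projection graph `Ξₙ`
(the product of the two projections is nonzero in the principal factor of the elements of
rank `n - 2`), and its red arcs are those given by the elements of `F`. -/
def Xi (n : ℕ) (F : Set (PartitionDiagram n)) : TwoColouredDigraph (XiVertex n) where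
  blue p q := (p.1 * q.1).rank + 2 = n
  red p q :=
    (∃ i, i + 1 < n ∧ tau n i ∈ F ∧ p.1 = tau n i ∧ q.1 = tau n i) ∨
    (∃ i, i + 2 < n ∧ lam n i ∈ F ∧ p.1 = tau n i ∧ q.1 = tau n (i + 1)) ∨
    (∃ i, i + 2 < n ∧ rho n i ∈ F ∧ p.1 = tau n (i + 1) ∧ q.1 = tau n i)

/-- `fₙ`: the number of sets of idempotents of rank `n - 2` that generate `𝒥ₙ ∖ {1}`. -/
noncomputable def numGeneratingSets (n : ℕ) : ℕ :=
  {F : Set (PartitionDiagram n) | F ⊆ subtopIdempotents n ∧ GeneratesSingularJones F}.ncard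

end PartitionDiagram

/-!
An element of `𝒥ₙ` of rank `n - 2` has one hook in each row, say at `i, i + 1` above and at
`j, j + 1` below; call it `h(i, j)`. The product `h(i, j) h(k, l)` is `h(i, l)` if `|j - k| ≤ 1` and
has smaller rank otherwise, so that the idempotents of rank `n - 2` are the `h(i, j)` with
`|i - j| ≤ 1`, and the factorizations of `h(i, j)` over `F` are the RBR-alternating paths from `τᵢ`
to `τⱼ` in `Ξₙ(F)`. As the `τᵢ` generate `𝒥ₙ`, this turns generation into the existence of circuits.

All arcs of `Ξₙ(F)` join equal or adjacent vertices of a path. Suppose there are no two opposite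
red arcs at `τᵢ` (in particular no red loop), and that a circuit leaves `τᵢ` by a red arc to the
right. Then its vertices after a red arc stay strictly to the right of `τᵢ`, since the red arc
leading back to `τᵢ` from its right neighbour is missing. Hence a circuit needs a red loop at `τᵢ`
or two opposite red arcs between `τᵢ` and a neighbour, and such configurations on a path are counted
by removing its first vertex.
-/

namespace PartitionDiagram

variable {n : ℕ} {T : Type*}

/-- A pair of colourings of the upper and the lower row by `T` is in the transfer relation of `α`
when every block of `α` is monochromatic. Products of diagrams become composites of relations,
which replaces computations with connected components. -/
def Transfer (α : PartitionDiagram n) (A B : Fin n → T) : Prop :=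
  α.rel ≤ Setoid.ker (Sum.elim A B)

theorem rel_ofGraph_le_ker_iff {e : DiagramVertex n → DiagramVertex n → Prop}
    {f : DiagramVertex n → T} :
    (ofGraph e).rel ≤ Setoid.ker f ↔ ∀ x y, e x y → f x = f y :=
  ⟨fun h _ _ hxy => h (.rel _ _ hxy), fun h => Setoid.eqvGen_le h⟩

theorem rel_iff_forall_transfer (α : PartitionDiagram n) (x y : DiagramVertex n) :
    α.rel x y ↔ ∀ A B : Fin n → Prop, α.Transfer A B → (Sum.elim A B x ↔ Sum.elim A B y) := by
  refine ⟨fun h A B hAB => iff_of_eq (hAB h), fun h => ?_⟩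
  have key := h (fun i => α.rel x (.inl i)) (fun i => α.rel x (.inr i)) fun u v huv => by
    have hx : α.rel x u = α.rel x v :=
      propext ⟨fun hu => α.rel.trans hu huv, fun hv => α.rel.trans hv (α.rel.symm huv)⟩
    cases u <;> cases v <;> exact hx
  have hx : α.rel x x ↔ α.rel x y := by cases x <;> cases y <;> exact key
  exact hx.1 (α.rel.refl x)

theorem ext_transfer {α β : PartitionDiagram n}
    (h : ∀ A B : Fin n → Prop, α.Transfer A B ↔ β.Transfer A B) : α = β := by
  ext x y
  simp only [rel_iff_forall_transfer, h]

@[simp]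
theorem transfer_one {A B : Fin n → T} : (1 : PartitionDiagram n).Transfer A B ↔ A = B := by
  refine rel_ofGraph_le_ker_iff.trans ⟨fun h => funext fun k => h (.inl k) (.inr k) rfl, ?_⟩
  rintro rfl (a | a) (b | b) hab
  case inl.inr => exact congrArg A hab
  all_goals exact hab.elim

@[simp]
theorem transfer_star {α : PartitionDiagram n} {A B : Fin n → T} :
    (star α).Transfer A B ↔ α.Transfer B A := by
  have elim_swap (A B : Fin n → T) (x) : Sum.elim A B x.swap = Sum.elim B A x := by
    cases x <;> rfl
  constructor
  · intro h x y hxy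
    have hxy' : (star α).rel x.swap y.swap := by
      change α.rel x.swap.swap y.swap.swap
      simpa only [Sum.swap_swap] using hxy
    exact (elim_swap A B x).symm.trans ((h hxy').trans (elim_swap A B y))
  · intro h x y hxy
    exact (elim_swap B A x).symm.trans ((h hxy).trans (elim_swap B A y))

theorem Transfer.mul {α β : PartitionDiagram n} {A B C : Fin n → T} (hα : α.Transfer A B)
    (hβ : β.Transfer B C) : (α * β).Transfer A C := by
  let colour : StackVertex n → T
    | .top k => A k
    | .mid k => B k
    | .bot k => C k
  have mono : Relation.EqvGen.setoid (StackEdge α β) ≤ Setoid.ker colour := by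
    refine Setoid.eqvGen_le ?_
    rintro _ _ (@⟨x, y, hxy⟩ | @⟨x, y, hxy⟩)
    · have := hα hxy
      cases x <;> cases y <;> exact this
    · have := hβ hxy
      cases x <;> cases y <;> exact this
  intro x y hxy
  have := mono hxy
  cases x <;> cases y <;> exact this

theorem Transfer.exists_of_mul [Nonempty T] {α β : PartitionDiagram n} {A C : Fin n → T}
    (h : (α * β).Transfer A C) : ∃ B, α.Transfer A B ∧ β.Transfer B C := by
  let components := Relation.EqvGen.setoid (StackEdge α β)
  let place (x : DiagramVertex n) := Quotient.mk components (outerPlace x)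
  have factors : (Sum.elim A C).FactorsThrough place := fun x y hxy =>
    h (Quotient.exact (s := components) hxy)
  obtain ⟨colour, hcolour⟩ : ∃ colour, ∀ x, colour (place x) = Sum.elim A C x :=
    ⟨Function.extend place (Sum.elim A C) fun _ => Classical.arbitrary T, factors.extend_apply _⟩
  have colour_edge {s t} (hst : StackEdge α β s t) : colour (.mk _ s) = colour (.mk _ t) :=
    congrArg colour (Quotient.sound (.rel _ _ hst))
  let B (k : Fin n) : T := colour (.mk _ (.mid k))
  have upper (x) : Sum.elim A B x = colour (.mk _ (upperPlace x)) := by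
    cases x with
    | inl k => exact (hcolour (.inl k)).symm
    | inr k => rfl
  have lower (x) : Sum.elim B C x = colour (.mk _ (lowerPlace x)) := by
    cases x with
    | inl k => rfl
    | inr k => exact (hcolour (.inr k)).symm
  exact ⟨B,
    fun x y hxy => (upper x).trans ((colour_edge (.upper hxy)).trans (upper y).symm),
    fun x y hxy => (lower x).trans ((colour_edge (.lower hxy)).trans (lower y).symm)⟩

@[simp]
theorem transfer_mul [Nonempty T] {α β : PartitionDiagram n} {A C : Fin n → T} :
    (α * β).Transfer A C ↔ ∃ B, α.Transfer A B ∧ β.Transfer B C :=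
  ⟨Transfer.exists_of_mul, fun ⟨_, hα, hβ⟩ => hα.mul hβ⟩

instance : Monoid (PartitionDiagram n) where
  mul_assoc α β γ := ext_transfer fun A D => by
    simp only [transfer_mul]
    exact ⟨fun ⟨C, ⟨B, hα, hβ⟩, hγ⟩ => ⟨B, hα, C, hβ, hγ⟩,
      fun ⟨B, hα, C, hβ, hγ⟩ => ⟨C, ⟨B, hα, hβ⟩, hγ⟩⟩
  one_mul α := ext_transfer fun A B => by simp
  mul_one α := ext_transfer fun A B => by simp

instance : StarMul (PartitionDiagram n) where
  star_involutive α := ext_transfer fun A B => by simp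
  star_mul α β := ext_transfer fun A B => by simp [and_comm]

theorem rank_eq_ncard (α : PartitionDiagram n) :
    α.rank = ((fun i => {x | α.rel x (.inl i)}) '' {i | ∃ j, α.rel (.inl i) (.inr j)}).ncard := by
  refine congrArg Set.ncard (Set.ext fun B => ⟨?_, ?_⟩)
  · rintro ⟨⟨y, rfl⟩, ⟨i, hi⟩, j, hj⟩
    refine ⟨i, ⟨j, α.rel.trans hi (α.rel.symm hj)⟩, Set.ext fun x => ?_⟩
    exact ⟨fun hx => α.rel.trans hx hi, fun hx => α.rel.trans hx (α.rel.symm hi)⟩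
  · rintro ⟨i, ⟨j, hij⟩, rfl⟩
    exact ⟨α.rel.mem_classes _, ⟨i, α.rel.refl _⟩, j, α.rel.symm hij⟩

theorem rel_mul_of_rel {α : PartitionDiagram n} {i j : Fin n} (β : PartitionDiagram n)
    (h : α.rel (.inl i) (.inl j)) : (α * β).rel (.inl i) (.inl j) :=
  .rel _ _ (.upper h)

theorem exists_rel_of_rel_mul {α β : PartitionDiagram n} {i j : Fin n}
    (h : (α * β).rel (.inl i) (.inr j)) : ∃ k, α.rel (.inl i) (.inr k) := by
  by_contra! hi
  have mono : α.Transfer (fun k => α.rel (.inl i) (.inl k)) (fun _ => False) := fun x y hxy => by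
    have colour (z) : Sum.elim (fun k => α.rel (.inl i) (.inl k)) (fun _ => False) z =
        α.rel (.inl i) z := by
      cases z with
      | inl k => rfl
      | inr k => exact (eq_false (hi k)).symm
    exact (colour x).trans ((propext ⟨fun hx => α.rel.trans hx hxy,
      fun hy => α.rel.trans hy (α.rel.symm hxy)⟩).trans (colour y).symm)
  have := (rel_iff_forall_transfer _ _ _).1 h _ _ (transfer_mul.2 ⟨_, mono, fun x y _ => by
    cases x <;> cases y <;> rfl⟩)
  exact this.1 (α.rel.refl _)

theorem rank_mul_le_left (α β : PartitionDiagram n) : (α * β).rank ≤ α.rank := by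
  let merge (B : Set (DiagramVertex n)) := {x | ∃ i, .inl i ∈ B ∧ (α * β).rel x (.inl i)}
  rw [rank_eq_ncard, rank_eq_ncard α]
  refine (Set.ncard_le_ncard ?_ (Set.toFinite _)).trans
    (Set.ncard_image_le (f := merge) (Set.toFinite _))
  rintro _ ⟨i, ⟨j, hij⟩, rfl⟩
  refine ⟨_, ⟨i, exists_rel_of_rel_mul hij, rfl⟩, Set.ext fun x => ⟨?_, ?_⟩⟩
  · rintro ⟨k, hk, hxk⟩
    exact (α * β).rel.trans hxk (rel_mul_of_rel β hk)
  · exact fun hx => ⟨i, α.rel.refl _, hx⟩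

@[simp]
theorem rank_star (α : PartitionDiagram n) : (star α).rank = α.rank := by
  have le (α : PartitionDiagram n) : (star α).rank ≤ α.rank := by
    refine (Set.ncard_le_ncard ?_ (Set.toFinite _)).trans
      (Set.ncard_image_le (f := (Sum.swap ⁻¹' ·)) (Set.toFinite _))
    rintro _ ⟨⟨y, rfl⟩, ⟨i, hi⟩, j, hj⟩
    exact ⟨_, ⟨⟨y.swap, rfl⟩, ⟨j, hj⟩, i, hi⟩, rfl⟩
  exact (le α).antisymm (by simpa only [star_star] using le (star α))

theorem rank_mul_le_right (α β : PartitionDiagram n) : (α * β).rank ≤ β.rank := by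
  rw [← rank_star, star_mul, ← rank_star β]
  exact rank_mul_le_left _ _

end PartitionDiagram

/-- A perfect matching of `V`, encoded as the fixed-point-free involution that exchanges matched
elements. -/
structure IsMatching {V : Type*} (σ : V → V) : Prop where
  involutive : Function.Involutive σ
  apply_ne : ∀ x, σ x ≠ x

/-- The matching obtained from `σ` by joining `p` to `q`, and their former partners to each
other. -/
def reconnect {V : Type*} [DecidableEq V] (p q : V) (σ : V → V) (x : V) : V :=
  if x = p then q else if x = q then p else if x = σ p then σ q else if x = σ q then σ p else σ x

namespace IsMatching

variable {V : Type*} [DecidableEq V] {σ : V → V}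

protected theorem reconnect (hσ : IsMatching σ) {p q : V} (hpq : p ≠ q) :
    IsMatching (reconnect p q σ) := by
  have := hσ.involutive
  have := hσ.apply_ne
  constructor <;> simp only [Function.Involutive, reconnect] at * <;> grind

theorem reconnect_reconnect (hσ : IsMatching σ) {p q r : V} (hq : σ p = q) :
    reconnect p q (reconnect p r σ) = σ := by
  have := hσ.involutive
  have := hσ.apply_ne
  funext x
  simp only [Function.Involutive, reconnect] at *
  grind

theorem forall_reconnect_iff (hσ : IsMatching σ) {T : Type*} {p q : V} (hpq : p ≠ q) {f : V → T} :
    (∀ x, f (reconnect p q σ x) = f x) ↔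
      f p = f q ∧ ∃ g : V → T, g p = g q ∧ (∀ x, x ≠ p → x ≠ q → f x = g x) ∧
        ∀ x, g (σ x) = g x := by
  have partner_eq_iff := fun {x y} => hσ.involutive.eq_iff (x := x) (y := y)
  have := hσ.apply_ne
  simp only [reconnect]
  constructor
  · intro hf
    refine ⟨by grind, ?_⟩
    by_cases hp : σ p = q
    · exact ⟨f, by grind⟩
    · exact ⟨fun x => if x = p ∨ x = q then f (σ p) else f x, by grind⟩
  · rintro ⟨hf, g, hg, hfg, hgσ⟩ x
    grind

end IsMatching

namespace PartitionDiagram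

variable {n m : ℕ} {T : Type*} {σ : DiagramVertex n → DiagramVertex n}

/-- The diagram whose blocks are the pairs of the matching `σ`. -/
def ofMatching (σ : DiagramVertex n → DiagramVertex n) : PartitionDiagram n :=
  ofGraph fun x y => σ x = y

theorem transfer_ofMatching {A B : Fin n → T} :
    (ofMatching σ).Transfer A B ↔ ∀ x, Sum.elim A B (σ x) = Sum.elim A B x :=
  rel_ofGraph_le_ker_iff.trans ⟨fun h x => (h x _ rfl).symm, fun h x _ hxy => hxy ▸ (h x).symm⟩

theorem rel_ofMatching (hσ : IsMatching σ) {x y : DiagramVertex n} :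
    (ofMatching σ).rel x y ↔ y = x ∨ y = σ x := by
  constructor
  · have mono : (ofMatching σ).rel ≤ Setoid.ker fun z => ({z, σ z} : Set (DiagramVertex n)) :=
      rel_ofGraph_le_ker_iff.2 fun z w hzw => by
        subst hzw
        simp only [hσ.involutive z, Set.pair_comm]
    intro hxy
    have hy : y ∈ ({y, σ y} : Set (DiagramVertex n)) := Set.mem_insert _ _
    have hxy' : ({x, σ x} : Set _) = {y, σ y} := mono hxy
    rwa [← hxy'] at hy
  · rintro (rfl | rfl)
    · exact (ofMatching σ).rel.refl _
    · exact .rel _ _ rfl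

theorem isBrauer_iff {α : PartitionDiagram n} :
    α.IsBrauer ↔ ∃ σ, IsMatching σ ∧ ofMatching σ = α := by
  constructor
  · intro hα
    have partner (x) : ∃ y, y ≠ x ∧ ∀ z, α.rel x z ↔ z = x ∨ z = y := by
      obtain ⟨a, b, hab, hblock⟩ := Set.ncard_eq_two.1 (hα _ (α.rel.mem_classes x))
      have hrel (z) : α.rel x z ↔ z = a ∨ z = b := α.rel.comm'.trans (Set.ext_iff.1 hblock z)
      rcases (hrel x).1 (α.rel.refl x) with rfl | rfl
      · exact ⟨b, hab.symm, hrel⟩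
      · exact ⟨a, hab, fun z => (hrel z).trans or_comm⟩
    choose σ hσ_ne hσ using partner
    have hmatch : IsMatching σ := by
      refine ⟨fun x => ?_, hσ_ne⟩
      have hx : α.rel (σ x) x := α.rel.symm ((hσ x (σ x)).2 (.inr rfl))
      exact (((hσ _ _).1 hx).resolve_left (hσ_ne x).symm).symm
    refine ⟨σ, hmatch, PartitionDiagram.ext <| Setoid.ext fun x y => ?_⟩
    rw [rel_ofMatching hmatch, hσ]
  · rintro ⟨σ, hσ, rfl⟩ _ ⟨y, rfl⟩
    have block : {x | (ofMatching σ).rel x y} = {y, σ y} := Set.ext fun x => by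
      rw [Set.mem_ofPred_eq, (ofMatching σ).rel.comm', rel_ofMatching hσ]; rfl
    rw [block, Set.ncard_pair (hσ.apply_ne y).symm]

theorem rank_ofMatching (hσ : IsMatching σ) :
    (ofMatching σ).rank = {k | (σ (.inl k)).isRight}.ncard := by
  have through : {i | ∃ j, (ofMatching σ).rel (.inl i) (.inr j)} = {k | (σ (.inl k)).isRight} :=
    Set.ext fun i => by
      simp only [Set.mem_ofPred_eq, rel_ofMatching hσ, reduceCtorEq, false_or,
        Sum.isRight_iff, eq_comm (b := σ _)]
  rw [rank_eq_ncard, through]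
  refine Set.InjOn.ncard_image fun i hi k _ hik => ?_
  have hik : (ofMatching σ).rel (.inl i) (.inl k) :=
    (Set.ext_iff.1 hik (.inl i)).1 ((ofMatching σ).rel.refl _)
  rcases (rel_ofMatching hσ).1 hik with h | h
  · exact (Sum.inl_injective h).symm
  · simp [← h] at hi

theorem IsBrauer.rank_add_card_le {α : PartitionDiagram n} (hα : α.IsBrauer) {s : Finset (Fin n)}
    (hs : ∀ i ∈ s, ∃ j ≠ i, α.rel (.inl i) (.inl j)) : α.rank + s.card ≤ n := by
  obtain ⟨σ, hσ, rfl⟩ := isBrauer_iff.1 hα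
  have disj : Disjoint {k | (σ (.inl k)).isRight} (s : Set (Fin n)) := by
    refine Set.disjoint_right.2 fun i hi hright => ?_
    obtain ⟨j, hji, hij⟩ := hs i hi
    rcases (rel_ofMatching hσ).1 hij with h | h
    · exact hji (Sum.inl_injective h)
    · simp [← h] at hright
  calc (ofMatching σ).rank + s.card = ({k | (σ (.inl k)).isRight} ∪ (s : Set (Fin n))).ncard := by
        rw [Set.ncard_union_eq disj, rank_ofMatching hσ, Set.ncard_coe_finset]
    _ ≤ n := by simpa using Set.ncard_le_card (α := Fin n) _

theorem isMatching_swap : IsMatching (Sum.swap : DiagramVertex n → DiagramVertex n) :=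
  ⟨Sum.swap_swap, by rintro (k | k) <;> simp⟩

theorem ofMatching_swap : ofMatching (Sum.swap : DiagramVertex n → DiagramVertex n) = 1 :=
  ext_transfer fun A B => by
    simp only [transfer_ofMatching, transfer_one, Sum.forall, Sum.swap_inl, Sum.swap_inr,
      Sum.elim_inl, Sum.elim_inr, funext_iff, eq_comm, and_self]

@[simp]
theorem rank_one : (1 : PartitionDiagram n).rank = n := by
  simp [← ofMatching_swap, rank_ofMatching isMatching_swap]

theorem transfer_tau {i : Fin m} {A B : Fin (m + 1) → T} :
    (tau (m + 1) i).Transfer A B ↔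
      A i.castSucc = A i.succ ∧ B i.castSucc = B i.succ ∧
        ∀ k, k ≠ i.castSucc → k ≠ i.succ → A k = B k := by
  refine rel_ofGraph_le_ker_iff.trans ?_
  simp only [Sum.forall, tauEdge, Sum.elim_inl, Sum.elim_inr]
  constructor
  · rintro ⟨upper, lower⟩
    refine ⟨(upper _).1 _ ⟨rfl, rfl⟩, (lower _).2 _ ⟨rfl, rfl⟩, fun k hk hk' => ?_⟩
    exact (upper k).2 k ⟨rfl, Fin.val_ne_of_ne hk, Fin.val_ne_of_ne hk'⟩
  · rintro ⟨hA, hB, hAB⟩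
    have pair {C : Fin (m + 1) → T} (hC : C i.castSucc = C i.succ) (a b : Fin (m + 1))
        (hab : a.val = i ∧ b.val = i + 1) : C a = C b := by
      rwa [show a = i.castSucc from Fin.ext hab.1, show b = i.succ from Fin.ext hab.2]
    refine ⟨fun a => ⟨pair hA a, ?_⟩, fun a => ⟨fun _ => False.elim, pair hB a⟩⟩
    rintro b ⟨rfl, ha, ha'⟩
    exact hAB a (mt (congrArg Fin.val) ha) (mt (congrArg Fin.val) ha')

theorem inl_castSucc_ne_inl_succ (i : Fin m) :
    (.inl i.castSucc : DiagramVertex (m + 1)) ≠ .inl i.succ :=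
  Sum.inl_injective.ne Fin.castSucc_lt_succ.ne

theorem tau_mul_ofMatching {σ : DiagramVertex (m + 1) → DiagramVertex (m + 1)} (hσ : IsMatching σ)
    (i : Fin m) :
    tau (m + 1) i * ofMatching σ = ofMatching (reconnect (.inl i.castSucc) (.inl i.succ) σ) := by
  refine ext_transfer fun A C => ?_
  rw [transfer_mul, transfer_ofMatching, hσ.forall_reconnect_iff (inl_castSucc_ne_inl_succ i)]
  simp only [transfer_tau, transfer_ofMatching]
  constructor
  · rintro ⟨B, ⟨hA, hB, hAB⟩, hBC⟩
    exact ⟨hA, Sum.elim B C, hB, by simpa using hAB, hBC⟩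
  · rintro ⟨hA, g, hg, hgA, hgσ⟩
    have hg_eq : g = Sum.elim (g ∘ .inl) C := by
      ext (k | k)
      · rfl
      · rw [← hgA (.inr k) (by simp) (by simp)]; rfl
    exact ⟨g ∘ .inl, ⟨hA, hg, fun k hk hk' => hgA (.inl k) (by simpa) (by simpa)⟩, hg_eq ▸ hgσ⟩

theorem tau_eq_ofMatching (i : Fin m) :
    tau (m + 1) i = ofMatching (reconnect (.inl i.castSucc) (.inl i.succ) Sum.swap) := by
  rw [← tau_mul_ofMatching isMatching_swap, ofMatching_swap, mul_one]

end PartitionDiagram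

section Noncrossing

variable {V ι : Type*} [LinearOrder ι] {a b c d e : ι} {pos : V → ι} {σ : V → V}

/-- The chords joining the points `a, b` and the points `c, d` of a circle cut open into a linear
order do not cross: `c` and `d` lie on the same side of the chord `ab`. -/
def Uncrossed (a b c d : ι) : Prop :=
  c ∈ Set.uIoo a b ↔ d ∈ Set.uIoo a b

theorem Uncrossed.symm (h : Uncrossed a b c d) (hac : a ≠ c) (had : a ≠ d) (hbc : b ≠ c)
    (hbd : b ≠ d) : Uncrossed c d a b := by
  simp only [Uncrossed, Set.uIoo, Set.mem_Ioo] at *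
  grind

theorem Uncrossed.swap_left (h : Uncrossed a b c d) : Uncrossed b a c d := by
  rwa [Uncrossed, Set.uIoo_comm]

theorem Uncrossed.swap_right (h : Uncrossed a b c d) : Uncrossed a b d c :=
  Iff.symm h

theorem Uncrossed.trans (hcd : Uncrossed a b c d) (hde : Uncrossed a b d e) : Uncrossed a b c e :=
  Iff.trans hcd hde

/-- No two pairs of the matching `σ` cross when its vertices are placed on a circle in the order
given by `pos`. -/
def Noncrossing (pos : V → ι) (σ : V → V) : Prop :=
  ∀ x z, z ≠ x → z ≠ σ x → Uncrossed (pos x) (pos (σ x)) (pos z) (pos (σ z))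

theorem IsMatching.uncrossed_symm (hσ : IsMatching σ) (hpos : Function.Injective pos) {x z : V}
    (hzx : z ≠ x) (hzσ : z ≠ σ x) (h : Uncrossed (pos x) (pos (σ x)) (pos z) (pos (σ z))) :
    Uncrossed (pos z) (pos (σ z)) (pos x) (pos (σ x)) :=
  h.symm (hpos.ne hzx.symm) (hpos.ne fun hx => hzσ ((hσ.involutive.eq_iff).1 hx.symm))
    (hpos.ne hzσ.symm) (hpos.ne (hσ.involutive.injective.ne hzx.symm))

theorem Noncrossing.reconnect [DecidableEq V] {p q : V} (hnc : Noncrossing pos σ)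
    (hσ : IsMatching σ) (hpos : Function.Injective pos) (hpq : p ≠ q)
    (hchord : ∀ z, z ≠ p → z ≠ q → Uncrossed (pos p) (pos q) (pos z) (pos (reconnect p q σ z))) :
    Noncrossing pos (reconnect p q σ) := by
  have hτ := hσ.reconnect hpq
  have hτ_def : ∀ x, _root_.reconnect p q σ x = if x = p then q else if x = q then p else
    if x = σ p then σ q else if x = σ q then σ p else σ x := fun _ => rfl
  generalize _root_.reconnect p q σ = τ at *
  have hσ_eq_iff := fun {x y} => hσ.involutive.eq_iff (x := x) (y := y)
  have joined {x z} (hx : x = p ∨ x = q) (hzx : z ≠ x) (hzτ : z ≠ τ x) :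
      Uncrossed (pos x) (pos (τ x)) (pos z) (pos (τ z)) := by
    rcases hx with rfl | rfl
    · rw [show τ x = q by grind] at *
      exact hchord z hzx hzτ
    · rw [show τ x = p by grind] at *
      exact (hchord z hzτ hzx).swap_left
  -- No other chord separates `p` from `σ p`, `p` from `q`, or `q` from `σ q`.
  have partners {x z} (hx : x = σ p ∨ x = σ q) (hxp : x ≠ p) (hxq : x ≠ q)
      (hz : z ≠ p ∧ z ≠ q ∧ z ≠ σ p ∧ z ≠ σ q) :
      Uncrossed (pos z) (pos (τ z)) (pos x) (pos (τ x)) := by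
    have hpq' : Uncrossed (pos z) (pos (τ z)) (pos p) (pos (τ p)) :=
      hτ.uncrossed_symm hpos (by grind) (by grind) (joined (.inl rfl) (by grind) (by grind))
    rw [show τ z = σ z by grind, show τ p = q by grind] at *
    have := ((hnc z p (by grind) (by grind)).swap_right.trans hpq').trans
      (hnc z q (by grind) (by grind))
    rcases hx with rfl | rfl
    · rwa [show τ (σ p) = σ q by grind]
    · rw [show τ (σ q) = σ p by grind]
      exact this.swap_right
  intro x z hzx hzτ
  have hxτ : x ≠ τ z := fun h => hzτ (hτ.involutive.eq_iff.1 h.symm)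
  have hsymm : _ → _ := hτ.uncrossed_symm hpos (x := z) (z := x) hzx.symm hxτ
  by_cases hx : x = p ∨ x = q
  · exact joined hx hzx hzτ
  by_cases hz : z = p ∨ z = q
  · exact hsymm (joined hz hzx.symm hxτ)
  by_cases hx' : x = σ p ∨ x = σ q
  · exact hsymm (partners hx' (by grind) (by grind) (by grind))
  by_cases hz' : z = σ p ∨ z = σ q
  · exact partners hz' (by grind) (by grind) (by grind)
  rw [show τ x = σ x by grind, show τ z = σ z by grind]
  exact hnc x z hzx (by grind)

end Noncrossing

namespace PartitionDiagram

variable {n m : ℕ}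

theorem boundaryPos_injective : Function.Injective (boundaryPos (n := n)) := by
  rintro (a | a) (b | b) hab <;> simp only [boundaryPos] at hab <;> grind

theorem IsPlanar.between_apply {σ : DiagramVertex n → DiagramVertex n}
    (h : (ofMatching σ).IsPlanar) (hσ : IsMatching σ) {a b : DiagramVertex n}
    (hab : boundaryPos a < boundaryPos b) (hb : boundaryPos b < boundaryPos (σ a)) :
    boundaryPos a < boundaryPos (σ b) ∧ boundaryPos (σ b) < boundaryPos (σ a) := by
  have hrel (a) : (ofMatching σ).rel a (σ a) := (rel_ofMatching hσ).2 (.inr rfl)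
  have no_crossing {a b} (hab : boundaryPos a < boundaryPos b)
      (hb : boundaryPos b < boundaryPos (σ a)) : ¬ boundaryPos (σ a) < boundaryPos (σ b) :=
    fun hlt => by
      rcases (rel_ofMatching hσ).1 (h a b (σ a) (σ b) hab hb hlt (hrel a) (hrel b)) with rfl | rfl
      · exact hab.false
      · exact hb.false
  have hσb : σ b ≠ a := fun h => by simp [← h, hσ.involutive b] at hb
  have hσ_ne : boundaryPos (σ b) ≠ boundaryPos (σ a) := fun h => by
    simp [hσ.involutive.injective (boundaryPos_injective h)] at hab
  have upper := no_crossing hab hb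
  have lower : boundaryPos (σ b) < boundaryPos a → _ := (no_crossing (a := σ b) (b := a) · ·)
  rw [hσ.involutive b] at lower
  have := boundaryPos_injective.ne hσb
  omega

theorem isPlanar_ofMatching_iff {σ : DiagramVertex n → DiagramVertex n} (hσ : IsMatching σ) :
    (ofMatching σ).IsPlanar ↔ Noncrossing boundaryPos σ := by
  constructor
  · intro h x z _ _
    have uncrossed {y} (hy : boundaryPos y < boundaryPos (σ y)) :
        Uncrossed (boundaryPos y) (boundaryPos (σ y)) (boundaryPos z) (boundaryPos (σ z)) := by
      simp only [Uncrossed, Set.uIoo_of_lt hy, Set.mem_Ioo]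
      refine ⟨fun hz => h.between_apply hσ hz.1 hz.2, fun hz => ?_⟩
      simpa only [hσ.involutive z] using h.between_apply hσ hz.1 hz.2
    rcases (boundaryPos_injective.ne (hσ.apply_ne x)).lt_or_gt with hx | hx
    · simpa only [hσ.involutive x] using (uncrossed (y := σ x) (by rwa [hσ.involutive x])).swap_left
    · exact uncrossed hx
  · intro h a b c d hab hbc hcd hac hbd
    have hac : c = σ a := ((rel_ofMatching hσ).1 hac).resolve_left (by rintro rfl; omega)
    have hbd : d = σ b := ((rel_ofMatching hσ).1 hbd).resolve_left (by rintro rfl; omega)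
    have := h a b (by rintro rfl; exact hab.false) (by rintro rfl; exact hbc.ne (by rw [hac]))
    simp only [Uncrossed, Set.uIoo, Set.mem_Ioo] at this
    grind

theorem mem_jones_iff {α : PartitionDiagram n} :
    α ∈ jones n ↔ ∃ σ, IsMatching σ ∧ Noncrossing boundaryPos σ ∧ ofMatching σ = α := by
  constructor
  · rintro ⟨hα, hplanar⟩
    obtain ⟨σ, hσ, rfl⟩ := isBrauer_iff.1 hα
    exact ⟨σ, hσ, (isPlanar_ofMatching_iff hσ).1 hplanar, rfl⟩
  · rintro ⟨σ, hσ, hnc, rfl⟩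
    exact ⟨isBrauer_iff.2 ⟨σ, hσ, rfl⟩, (isPlanar_ofMatching_iff hσ).2 hnc⟩

theorem one_mem_jones : (1 : PartitionDiagram n) ∈ jones n := by
  refine mem_jones_iff.2 ⟨Sum.swap, isMatching_swap, ?_, ofMatching_swap⟩
  rintro (x | x) (z | z) hx hz <;>
    simp only [Sum.swap_inl, Sum.swap_inr, ne_eq, Sum.inl.injEq, Sum.inr.injEq] at hx hz <;>
    simp only [Uncrossed, Set.uIoo, Set.mem_Ioo, boundaryPos, Sum.swap_inl, Sum.swap_inr] <;>
    grind

theorem tau_mul_mem_jones {α : PartitionDiagram (m + 1)} (i : Fin m) (hα : α ∈ jones (m + 1)) :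
    tau (m + 1) i * α ∈ jones (m + 1) := by
  obtain ⟨σ, hσ, hnc, rfl⟩ := mem_jones_iff.1 hα
  have hi := inl_castSucc_ne_inl_succ i
  rw [tau_mul_ofMatching hσ]
  refine mem_jones_iff.2 ⟨_, hσ.reconnect hi, hnc.reconnect hσ boundaryPos_injective hi ?_, rfl⟩
  have between (k : ℕ) : k ∉ Set.uIoo (i : ℕ) (i + 1) := by
    simp
  exact fun z _ _ => iff_of_false (between _) (between _)

end PartitionDiagram

theorem reconnect_comm {V : Type*} [DecidableEq V] {σ : V → V} (hσ : IsMatching σ) (p q : V) :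
    reconnect p q σ = reconnect q p σ := by
  have := hσ.involutive.injective
  funext x
  grind [reconnect, Function.Injective]

theorem IsMatching.reconnect_eq_self {V : Type*} [DecidableEq V] {σ : V → V} (hσ : IsMatching σ)
    {p q : V} (hq : σ p = q) : _root_.reconnect p q σ = σ := by
  have := hσ.involutive p
  funext x
  grind [_root_.reconnect]

namespace PartitionDiagram

variable {n m : ℕ}

/-- The diagram `α` has an upper hook at `i`: its upper vertices `i` and `i + 1` are in the same
block. -/
def HasUpperHook (α : PartitionDiagram (m + 1)) (i : Fin m) : Prop :=
  α.rel (.inl i.castSucc) (.inl i.succ)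

/-- Adjacency in the blue graph of the `τᵢ`: the indices differ by at most one. -/
def Near (i j : Fin m) : Prop :=
  (i : ℕ) ≤ j + 1 ∧ (j : ℕ) ≤ i + 1

theorem hasUpperHook_tau_mul (i : Fin m) (α : PartitionDiagram (m + 1)) :
    HasUpperHook (tau (m + 1) i * α) i :=
  rel_mul_of_rel α (.rel _ _ ⟨rfl, rfl⟩)

theorem hasUpperHook_ofMatching {σ : DiagramVertex (m + 1) → DiagramVertex (m + 1)}
    (hσ : IsMatching σ) {i : Fin m} :
    HasUpperHook (ofMatching σ) i ↔ σ (.inl i.castSucc) = .inl i.succ := by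
  rw [HasUpperHook, rel_ofMatching hσ, or_iff_right (inl_castSucc_ne_inl_succ i).symm, eq_comm]

theorem HasUpperHook.tau_mul {α : PartitionDiagram (m + 1)} {i : Fin m} (hi : HasUpperHook α i)
    (hα : α.IsBrauer) : tau (m + 1) i * α = α := by
  obtain ⟨σ, hσ, rfl⟩ := isBrauer_iff.1 hα
  rw [tau_mul_ofMatching hσ, hσ.reconnect_eq_self ((hasUpperHook_ofMatching hσ).1 hi)]

theorem HasUpperHook.tau_mul_tau_mul {α : PartitionDiagram (m + 1)} {i j : Fin m}
    (hi : HasUpperHook α i) (hα : α.IsBrauer) (hij : Near i j) :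
    tau (m + 1) i * (tau (m + 1) j * α) = α := by
  obtain ⟨σ, hσ, rfl⟩ := isBrauer_iff.1 hα
  have hpq := (hasUpperHook_ofMatching hσ).1 hi
  have hτ := hσ.reconnect (inl_castSucc_ne_inl_succ j)
  rcases lt_trichotomy i j with hlt | rfl | hlt
  · have hj : j.castSucc = i.succ := Fin.ext (by simp [Near] at *; omega)
    rw [tau_mul_ofMatching hσ, tau_mul_ofMatching hτ, reconnect_comm hτ, hj,
      hσ.reconnect_reconnect (hσ.involutive.eq_iff.1 hpq).symm]
  · rw [hi.tau_mul hα, hi.tau_mul hα]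
  · have hj : j.succ = i.castSucc := Fin.ext (by simp [Near] at *; omega)
    rw [tau_mul_ofMatching hσ, tau_mul_ofMatching hτ, reconnect_comm hσ, hj,
      hσ.reconnect_reconnect hpq]

theorem rel_tau_mul {α : PartitionDiagram (m + 1)} {i : Fin m} {x y : DiagramVertex (m + 1)}
    (h : α.rel x y) (hx : x ≠ .inl i.castSucc ∧ x ≠ .inl i.succ)
    (hy : y ≠ .inl i.castSucc ∧ y ≠ .inl i.succ) : (tau (m + 1) i * α).rel x y := by
  refine (rel_iff_forall_transfer _ _ _).2 fun A C hAC => ?_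
  obtain ⟨B, hτ, hBC⟩ := transfer_mul.1 hAC
  have colour {z : DiagramVertex (m + 1)} (hz : z ≠ .inl i.castSucc ∧ z ≠ .inl i.succ) :
      Sum.elim A C z = Sum.elim B C z := by
    cases z with
    | inl k => exact (transfer_tau.1 hτ).2.2 k (by simpa using hz.1) (by simpa using hz.2)
    | inr k => rfl
  rw [colour hx, colour hy]
  exact (rel_iff_forall_transfer _ _ _).1 h _ _ hBC

theorem exists_hook_of_upper_chord {σ : DiagramVertex (m + 1) → DiagramVertex (m + 1)}
    (hσ : IsMatching σ) (hnc : Noncrossing boundaryPos σ) {a c : Fin (m + 1)} (hac : a < c)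
    (h : σ (.inl a) = .inl c) : ∃ i : Fin m, σ (.inl i.castSucc) = .inl i.succ := by
  induction c using Fin.induction generalizing a with
  | zero => exact absurd hac (Fin.not_lt_zero a)
  | succ i ih =>
    obtain rfl | hai := (Fin.le_castSucc_iff.2 hac).eq_or_lt
    · exact ⟨i, h⟩
    -- The partner of `i` lies strictly inside the chord from `a` to `i + 1`.
    have inside : boundaryPos (σ (.inl i.castSucc)) ∈ Set.Ioo (a : ℕ) i.succ := by
      have uncrossed := hnc (.inl a) (.inl i.castSucc) (by simpa using hai.ne')
        (by rw [h]; exact inl_castSucc_ne_inl_succ i)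
      have hac' : boundaryPos (.inl a) < boundaryPos (.inl i.succ) := hac
      rw [h, Uncrossed, Set.uIoo_of_lt hac'] at uncrossed
      exact uncrossed.1 ⟨hai, Fin.castSucc_lt_succ⟩
    rcases hb : σ (.inl i.castSucc) with b | b
    · have hbi : b ≤ i.castSucc := Fin.le_def.2 (by simpa [hb, boundaryPos] using inside.2)
      have hne : b ≠ i.castSucc := fun h => hσ.apply_ne _ (hb.trans (congrArg _ h))
      exact ih (hbi.lt_of_ne hne) (hσ.involutive.eq_iff.1 hb).symm
    · simp only [hb, boundaryPos, Fin.val_succ, Set.mem_Ioo] at *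
      omega

theorem exists_hook_of_ne_swap {σ : DiagramVertex (m + 1) → DiagramVertex (m + 1)}
    (hσ : IsMatching σ) (hnc : Noncrossing boundaryPos σ) (hne : σ ≠ Sum.swap) :
    ∃ i : Fin m, σ (.inl i.castSucc) = .inl i.succ := by
  by_cases hchord : ∃ a c, a < c ∧ σ (.inl a) = .inl c
  · obtain ⟨a, c, hac, h⟩ := hchord
    exact exists_hook_of_upper_chord hσ hnc hac h
  have through (a) : ∃ b, σ (.inl a) = .inr b := by
    push Not at hchord
    rcases h : σ (.inl a) with c | b
    · rcases lt_trichotomy a c with hac | rfl | hca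
      · exact absurd h (hchord a c hac)
      · exact absurd h (hσ.apply_ne _)
      · exact absurd (hσ.involutive.eq_iff.1 h).symm (hchord c a hca)
    · exact ⟨b, rfl⟩
  choose f hf using through
  have mono : StrictMono f := fun a b hab => by
    have hf_ne : f a ≠ f b := fun h =>
      hab.ne (Sum.inl_injective (hσ.involutive.injective (by rw [hf, hf, h])))
    have uncrossed := hnc (.inl a) (.inl b) (by simpa using hab.ne') (by simp [hf])
    simp only [hf, Uncrossed, boundaryPos, Set.uIoo, Set.mem_Ioo, Fin.lt_def, ne_eq,
      Fin.ext_iff] at *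
    omega
  refine absurd (funext ?_) hne
  rintro (a | a)
  · rw [hf, mono.eq_id]; rfl
  · rw [Sum.swap_inr, hσ.involutive.eq_iff, hf, mono.eq_id]; rfl

theorem exists_hasUpperHook {α : PartitionDiagram (m + 1)} (hα : α ∈ jones (m + 1)) (hne : α ≠ 1) :
    ∃ i, HasUpperHook α i := by
  obtain ⟨σ, hσ, hnc, rfl⟩ := mem_jones_iff.1 hα
  simp only [hasUpperHook_ofMatching hσ]
  exact exists_hook_of_ne_swap hσ hnc (by rintro rfl; exact hne ofMatching_swap)

/-- The first `j` strings of the diagram `α` are vertical. -/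
def StraightBelow (j : ℕ) (α : PartitionDiagram n) : Prop :=
  ∀ k : Fin n, (k : ℕ) < j → α.rel (.inl k) (.inr k)

theorem straightBelow_ofMatching {σ : DiagramVertex n → DiagramVertex n} (hσ : IsMatching σ)
    {j : ℕ} : StraightBelow j (ofMatching σ) ↔ ∀ k : Fin n, (k : ℕ) < j → σ (.inl k) = .inr k := by
  simp only [StraightBelow, rel_ofMatching hσ, reduceCtorEq, false_or, eq_comm]

theorem uncrossed_column {τ : DiagramVertex n → DiagramVertex n} (hτ : IsMatching τ) {j : Fin n}
    (straight : ∀ k ≤ j, τ (.inl k) = .inr k) (z : DiagramVertex n) :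
    Uncrossed (boundaryPos (.inl j)) (boundaryPos (.inr j)) (boundaryPos z)
      (boundaryPos (τ z)) := by
  have between (x : DiagramVertex n) :
      boundaryPos x ∈ Set.uIoo (boundaryPos (.inl j)) (boundaryPos (.inr j)) ↔
        j < Sum.elim id id x := by
    rcases x with k | k <;> simp only [boundaryPos, Set.uIoo, Set.mem_Ioo, Sum.elim_inl,
      Sum.elim_inr, id_eq, Fin.lt_def] <;> grind
  have column_le {x} (hx : Sum.elim id id x ≤ j) : Sum.elim id id (τ x) ≤ j := by
    rcases x with k | k
    · rwa [straight k hx]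
    · rwa [← hτ.involutive.eq_iff.1 (straight k hx)]
  rw [Uncrossed, between, between, ← not_iff_not, not_lt, not_lt]
  exact ⟨column_le, fun h => by simpa only [hτ.involutive z] using column_le h⟩

theorem exists_tau_mul_eq_of_straightBelow {α : PartitionDiagram (m + 1)} {j : Fin m}
    (hα : α ∈ jones (m + 1)) (hj : HasUpperHook α j) (straight : StraightBelow j α) :
    ∃ β ∈ jones (m + 1), StraightBelow (j + 1) β ∧ tau (m + 1) j * β = α := by
  obtain ⟨σ, hσ, hnc, rfl⟩ := mem_jones_iff.1 hα
  rw [hasUpperHook_ofMatching hσ] at hj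
  rw [straightBelow_ofMatching hσ] at straight
  have hne : (.inl j.castSucc : DiagramVertex (m + 1)) ≠ .inr j.castSucc := Sum.inl_ne_inr
  have hτ := hσ.reconnect hne
  have straight_reconnect (k : Fin (m + 1)) (hk : k ≤ j.castSucc) :
      reconnect (.inl j.castSucc) (.inr j.castSucc) σ (.inl k) = .inr k := by
    rcases hk.eq_or_lt with rfl | hk
    · simp [reconnect]
    · have hkσ := straight k hk
      have hkj : (.inl k : DiagramVertex (m + 1)) ≠ σ (.inr j.castSucc) := fun h =>
        hk.ne (Sum.inr_injective (hkσ.symm.trans (hσ.involutive.eq_iff.1 h.symm).symm))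
      have hkj' : k ≠ j.succ := (hk.trans Fin.castSucc_lt_succ).ne
      simp [reconnect, hj, hkσ, hkj, hkj', hk.ne]
  refine ⟨ofMatching (reconnect (.inl j.castSucc) (.inr j.castSucc) σ), ?_, ?_, ?_⟩
  · exact mem_jones_iff.2 ⟨_, hτ, hnc.reconnect hσ boundaryPos_injective hne
      fun z _ _ => uncrossed_column hτ straight_reconnect z, rfl⟩
  · rw [straightBelow_ofMatching hτ]
    exact fun k hk => straight_reconnect k (Nat.lt_succ_iff.1 hk)
  · rw [tau_mul_ofMatching hτ, hσ.reconnect_reconnect hj]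

theorem StraightBelow.tau_mul {α : PartitionDiagram (m + 1)} {j : ℕ} (h : StraightBelow j α)
    {i : Fin m} (hi : j ≤ i) : StraightBelow j (tau (m + 1) i * α) := by
  intro k hk
  refine rel_tau_mul (h k hk) ⟨?_, ?_⟩ (by simp) <;>
    simp only [ne_eq, Sum.inl.injEq, Fin.ext_iff, Fin.val_castSucc, Fin.val_succ] <;> omega

theorem StraightBelow.le_of_hasUpperHook {α : PartitionDiagram (m + 1)} {j : ℕ}
    (h : StraightBelow j α) (hα : α.IsBrauer) {i : Fin m} (hi : HasUpperHook α i) : j ≤ i := by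
  obtain ⟨σ, hσ, rfl⟩ := isBrauer_iff.1 hα
  by_contra! hij
  have := (straightBelow_ofMatching hσ).1 h i.castSucc hij
  rw [(hasUpperHook_ofMatching hσ).1 hi] at this
  exact Sum.inl_ne_inr this

/-- The submonoid of the partition monoid generated by the `τᵢ`. -/
def tauClosure (m : ℕ) : Submonoid (PartitionDiagram (m + 1)) :=
  Submonoid.closure (Set.range fun i : Fin m => tau (m + 1) i)

theorem tau_mem_tauClosure (i : Fin m) : tau (m + 1) i ∈ tauClosure m :=
  Submonoid.subset_closure ⟨i, rfl⟩

theorem mem_tauClosure_of_hasUpperHook {j : Fin m}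
    (ih : ∀ β ∈ jones (m + 1), StraightBelow (j + 1) β → β ∈ tauClosure m) (i : Fin m)
    (hji : j ≤ i) {α : PartitionDiagram (m + 1)} (hα : α ∈ jones (m + 1))
    (straight : StraightBelow j α) (hi : HasUpperHook α i) : α ∈ tauClosure m := by
  obtain rfl | hlt := hji.eq_or_lt
  · obtain ⟨β, hβ, straight', rfl⟩ := exists_tau_mul_eq_of_straightBelow hα hi straight
    exact mul_mem (tau_mem_tauClosure _) (ih β hβ straight')
  · obtain ⟨k, hk⟩ : ∃ k : Fin m, (k : ℕ) + 1 = i := ⟨⟨i - 1, by omega⟩, by simp; omega⟩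
    rw [← hi.tau_mul_tau_mul hα.1 (j := k) (by simp [Near]; omega)]
    exact mul_mem (tau_mem_tauClosure _) <| mem_tauClosure_of_hasUpperHook ih k (by omega)
      (tau_mul_mem_jones k hα) (straight.tau_mul (by omega)) (hasUpperHook_tau_mul k α)
termination_by (i : ℕ)

theorem mem_tauClosure_of_straightBelow {j : ℕ} (hj : j ≤ m + 1) {α : PartitionDiagram (m + 1)}
    (hα : α ∈ jones (m + 1)) (straight : StraightBelow j α) : α ∈ tauClosure m := by
  induction hj using Nat.decreasingInduction generalizing α with
  | self =>
    by_cases hne : α = 1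
    · exact hne ▸ one_mem _
    · obtain ⟨i, hi⟩ := exists_hasUpperHook hα hne
      have := straight.le_of_hasUpperHook hα.1 hi
      omega
  | of_succ j _ ih =>
    by_cases hne : α = 1
    · exact hne ▸ one_mem _
    · obtain ⟨i, hi⟩ := exists_hasUpperHook hα hne
      have hji := straight.le_of_hasUpperHook hα.1 hi
      exact mem_tauClosure_of_hasUpperHook (j := ⟨j, hji.trans_lt i.2⟩)
        (fun β hβ hβ' => ih hβ hβ') i hji hα straight hi

theorem coe_tauClosure : (tauClosure m : Set (PartitionDiagram (m + 1))) = jones (m + 1) := by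
  refine Set.Subset.antisymm (fun α hα => ?_) fun α hα =>
    mem_tauClosure_of_straightBelow (Nat.zero_le _) hα fun k hk => absurd hk (Nat.not_lt_zero _)
  induction hα using Submonoid.closure_induction_left with
  | one => exact one_mem_jones
  | mul_left x hx y _ hy =>
    obtain ⟨i, rfl⟩ := hx
    exact tau_mul_mem_jones i hy

theorem Near.refl (i : Fin m) : Near i i := by
  simp [Near]

theorem Near.symm {i j : Fin m} (h : Near i j) : Near j i :=
  And.symm h

theorem Near.induction {P : Fin m → Prop} {j : Fin m} (base : P j)
    (step : ∀ i k, Near i k → P k → P i) (i : Fin m) : P i := by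
  have dist_induction (d : ℕ) : ∀ i : Fin m, (i : ℕ) - j + (j - i) = d → P i := by
    induction d with
    | zero => exact fun i hi => (show i = j by omega) ▸ base
    | succ d ih =>
      intro i hi
      rcases lt_or_ge i j with hij | hij
      · exact step i ⟨i + 1, by omega⟩ (by simp [Near]; omega) (ih _ (by simp; omega))
      · exact step i ⟨i - 1, by omega⟩ (by simp [Near]; omega) (ih _ (by simp; omega))
  exact dist_induction _ i rfl

theorem HasUpperHook.rank_lt {α : PartitionDiagram (m + 1)} {i j : Fin m} (hi : HasUpperHook α i)
    (hj : HasUpperHook α j) (hα : α.IsBrauer) (hij : i ≠ j) : α.rank + 2 < m + 1 := by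
  wlog hlt : i < j generalizing i j
  · exact this hj hi hij.symm (hij.lt_or_gt.resolve_left hlt)
  have card : ({i.castSucc, i.succ, j.succ} : Finset (Fin (m + 1))).card = 3 :=
    Finset.card_eq_three.2 ⟨_, _, _, Fin.castSucc_lt_succ.ne,
      (Fin.castSucc_lt_succ.trans (Fin.succ_lt_succ_iff.2 hlt)).ne,
      (Fin.succ_lt_succ_iff.2 hlt).ne, rfl⟩
  have := hα.rank_add_card_le (s := {i.castSucc, i.succ, j.succ}) (by
    simp only [Finset.mem_insert, Finset.mem_singleton]
    rintro _ (rfl | rfl | rfl)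
    · exact ⟨_, Fin.castSucc_lt_succ.ne', hi⟩
    · exact ⟨_, Fin.castSucc_lt_succ.ne, α.rel.symm hi⟩
    · exact ⟨_, Fin.castSucc_lt_succ.ne, α.rel.symm hj⟩)
  omega

theorem HasUpperHook.eq_of_rank {α : PartitionDiagram (m + 1)} {i j : Fin m}
    (hi : HasUpperHook α i) (hj : HasUpperHook α j) (hα : α.IsBrauer) (hrank : α.rank + 2 = m + 1) :
    i = j := by
  by_contra hij
  exact (hi.rank_lt hj hα hij).ne hrank

theorem HasUpperHook.tau_mul_of_not_near {α : PartitionDiagram (m + 1)} {i j : Fin m}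
    (hj : HasUpperHook α j) (hij : ¬ Near i j) : HasUpperHook (tau (m + 1) i * α) j := by
  unfold Near at hij
  refine rel_tau_mul hj ⟨?_, ?_⟩ ⟨?_, ?_⟩ <;>
    simp only [ne_eq, Sum.inl.injEq, Fin.ext_iff, Fin.val_castSucc, Fin.val_succ] <;> omega

theorem rank_tau (i : Fin m) : (tau (m + 1) i).rank + 2 = m + 1 := by
  have hne := Fin.castSucc_lt_succ (i := i).ne
  have through : {k | (reconnect (.inl i.castSucc) (.inl i.succ) Sum.swap (.inl k) :
      DiagramVertex (m + 1)).isRight} = ({i.castSucc, i.succ} : Set (Fin (m + 1)))ᶜ := by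
    ext k
    simp only [reconnect, Set.mem_ofPred_eq, Set.mem_compl_iff, Set.mem_insert_iff]
    grind [Sum.swap]
  rw [tau_eq_ofMatching, rank_ofMatching (isMatching_swap.reconnect (inl_castSucc_ne_inl_succ i)),
    through, ← Set.ncard_pair hne, add_comm, Set.ncard_add_ncard_compl, Nat.card_fin]

theorem star_tau (i : Fin m) : star (tau (m + 1) i) = tau (m + 1) i :=
  ext_transfer fun A B => by
    simp only [transfer_star, transfer_tau, eq_comm (a := A _) (b := B _), and_left_comm]

theorem tau_mem_jones (i : Fin m) : tau (m + 1) i ∈ jones (m + 1) :=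
  mul_one (tau (m + 1) i) ▸ tau_mul_mem_jones i one_mem_jones

theorem hasUpperHook_tau (i : Fin m) : HasUpperHook (tau (m + 1) i) i :=
  mul_one (tau (m + 1) i) ▸ hasUpperHook_tau_mul i 1

/-- The product `τₖ ⋯ τ₁ τ₀`. -/
def descent (m : ℕ) : ℕ → PartitionDiagram (m + 1)
  | 0 => tau (m + 1) 0
  | k + 1 => tau (m + 1) (k + 1) * descent m k

theorem descent_mem_jones (i : Fin m) : descent m i ∈ jones (m + 1) := by
  obtain ⟨k, hk⟩ := i
  induction k with
  | zero => exact tau_mem_jones ⟨0, hk⟩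
  | succ k ih => exact tau_mul_mem_jones ⟨k + 1, hk⟩ (ih (by omega))

theorem hasUpperHook_descent (i : Fin m) : HasUpperHook (descent m i) i := by
  obtain ⟨_ | k, hk⟩ := i
  · exact hasUpperHook_tau ⟨0, hk⟩
  · exact hasUpperHook_tau_mul ⟨k + 1, hk⟩ _

theorem tau_mul_descent {i j : Fin m} (hij : Near i j) :
    tau (m + 1) i * descent m j = descent m i := by
  have hi := hasUpperHook_descent i
  have hJ := (descent_mem_jones i).1
  obtain h | h | h : i = j ∨ (i : ℕ) = j + 1 ∨ (j : ℕ) = i + 1 := by unfold Near at hij; omega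
  · rw [← h, hi.tau_mul hJ]
  · rw [h, descent]
  · have := hi.tau_mul_tau_mul hJ hij
    rwa [h] at this ⊢

/-- The element of `𝒥ₘ₊₁` of rank `m - 1` whose upper vertices `i, i + 1` and lower vertices
`j, j + 1` are joined to each other, encoded as the product `τᵢ ⋯ τ₁ τ₀ τ₀ τ₁ ⋯ τⱼ`, which
spares a distinction between `i ≤ j` and `j ≤ i`. -/
def hook (i j : Fin m) : PartitionDiagram (m + 1) :=
  descent m i * star (descent m j)

@[simp]
theorem star_hook (i j : Fin m) : star (hook i j) = hook j i := by
  simp [hook]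

theorem tau_mul_hook {i j : Fin m} (hij : Near i j) (k : Fin m) :
    tau (m + 1) i * hook j k = hook i k := by
  rw [hook, ← mul_assoc, tau_mul_descent hij, hook]

theorem hook_self (i : Fin m) : hook i i = tau (m + 1) i := by
  induction hk : (i : ℕ) generalizing i with
  | zero =>
    rw [hook, hk, descent, ← hk, star_tau, (hasUpperHook_tau i).tau_mul (tau_mem_jones i).1]
  | succ k ih =>
    obtain ⟨j, hj⟩ : ∃ j : Fin m, (j : ℕ) = k := ⟨⟨k, by omega⟩, rfl⟩
    have hij : Near i j := by simp [Near]; omega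
    have braid := (hasUpperHook_tau i).tau_mul_tau_mul (tau_mem_jones i).1 hij
    rw [← hk, ← tau_mul_hook hij, ← star_hook, ← tau_mul_hook hij, star_mul, star_hook, star_tau,
      ih j hj, ← hj, braid]

theorem hook_mul_tau (i : Fin m) {j k : Fin m} (hjk : Near j k) :
    hook i j * tau (m + 1) k = hook i k := by
  rw [← star_hook, ← star_tau, ← star_mul, tau_mul_hook hjk.symm, star_hook]

theorem hook_mul_hook (i l : Fin m) {j k : Fin m} (hjk : Near j k) :
    hook i j * hook k l = hook i l := by
  induction i using Near.induction (j := j) with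
  | base => rw [hook_self, tau_mul_hook hjk]
  | step i i' hii' ih => rw [← tau_mul_hook hii', mul_assoc, ih, tau_mul_hook hii']

theorem hasUpperHook_hook (i j : Fin m) : HasUpperHook (hook i j) i :=
  rel_mul_of_rel _ (hasUpperHook_descent i)

theorem hook_mem_jones (i j : Fin m) : hook i j ∈ jones (m + 1) := by
  induction i using Near.induction (j := j) with
  | base => exact hook_self j ▸ tau_mem_jones j
  | step i i' hii' ih => exact tau_mul_hook hii' j ▸ tau_mul_mem_jones i ih

theorem rank_hook (i j : Fin m) : (hook i j).rank + 2 = m + 1 := by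
  have le : (hook i j).rank ≤ (tau (m + 1) i).rank := by
    rw [← tau_mul_hook (.refl i) j]
    exact rank_mul_le_left _ _
  have ge : (tau (m + 1) i).rank ≤ (hook i j).rank := by
    rw [← hook_self, ← hook_mul_hook i i (.refl j)]
    exact rank_mul_le_left _ _
  rw [le.antisymm ge, rank_tau]

theorem hook_inj {i j k l : Fin m} : hook i j = hook k l ↔ i = k ∧ j = l := by
  refine ⟨fun h => ?_, by rintro ⟨rfl, rfl⟩; rfl⟩
  have upper_eq {i j k l : Fin m} (h : hook i j = hook k l) : i = k :=
    (hasUpperHook_hook i j).eq_of_rank (h ▸ hasUpperHook_hook k l) (hook_mem_jones i j).1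
      (rank_hook i j)
  exact ⟨upper_eq h, upper_eq (by simpa using congrArg star h)⟩

theorem rank_tau_mul_hook_lt {i j : Fin m} (hij : ¬ Near i j) (k : Fin m) :
    (tau (m + 1) i * hook j k).rank + 2 < m + 1 :=
  (hasUpperHook_tau_mul i _).rank_lt ((hasUpperHook_hook j k).tau_mul_of_not_near hij)
    (tau_mul_mem_jones i (hook_mem_jones j k)).1 fun h => hij (h ▸ .refl i)

theorem rank_hook_mul_hook_lt (i l : Fin m) {j k : Fin m} (hjk : ¬ Near j k) :
    (hook i j * hook k l).rank + 2 < m + 1 := by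
  rw [← hook_mul_tau i (.refl j), mul_assoc]
  exact (Nat.add_le_add_right (rank_mul_le_right _ _) 2).trans_lt (rank_tau_mul_hook_lt hjk l)

theorem rank_lt_or_eq_hook {α : PartitionDiagram (m + 1)} (hα : α ∈ jones (m + 1)) (hne : α ≠ 1) :
    α.rank + 2 < m + 1 ∨ ∃ i j, α = hook i j := by
  rw [← coe_tauClosure] at hα
  refine or_iff_not_imp_left.1 ?_ hne
  clear hne
  induction hα using Submonoid.closure_induction_left with
  | one => exact .inl rfl
  | mul_left x hx β _ ih =>
    obtain ⟨i, rfl⟩ := hx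
    obtain rfl | hrank | ⟨j, k, rfl⟩ := ih
    · exact .inr (.inr ⟨i, i, by rw [mul_one, hook_self]⟩)
    · exact .inr (.inl ((Nat.add_le_add_right (rank_mul_le_right _ _) 2).trans_lt hrank))
    · by_cases hij : Near i j
      · exact .inr (.inr ⟨i, k, tau_mul_hook hij k⟩)
      · exact .inr (.inl (rank_tau_mul_hook_lt hij k))

theorem mem_subtopIdempotents_iff {α : PartitionDiagram (m + 1)} :
    α ∈ subtopIdempotents (m + 1) ↔ ∃ i j, Near i j ∧ α = hook i j := by
  constructor
  · rintro ⟨hα, hidem, hrank⟩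
    have hne : α ≠ 1 := by
      rintro rfl
      rw [rank_one] at hrank
      omega
    obtain ⟨i, j, rfl⟩ := (rank_lt_or_eq_hook hα hne).resolve_left hrank.not_lt
    refine ⟨i, j, ?_, rfl⟩
    by_contra hij
    have := rank_hook_mul_hook_lt i j (mt Near.symm hij)
    rw [hidem.eq] at this
    exact this.ne hrank
  · rintro ⟨i, j, hij, rfl⟩
    exact ⟨hook_mem_jones i j, hook_mul_hook i j hij.symm, rank_hook i j⟩

theorem star_lam (n i : ℕ) : star (lam n i) = rho n i :=
  ext_transfer fun A B => by
    rw [transfer_star, Transfer, Transfer, lam, rho, rel_ofGraph_le_ker_iff, rel_ofGraph_le_ker_iff]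
    simp only [Sum.forall, lamEdge, rhoEdge, Sum.elim_inl, Sum.elim_inr]
    grind

theorem lam_eq_hook {i j : Fin m} (hij : (j : ℕ) = i + 1) : lam (m + 1) i = hook i j := by
  have hnear : Near i j := by simp [Near]; omega
  have val_eq (a : Fin (m + 1)) : ((a : ℕ) = i ↔ a = i.castSucc) ∧ ((a : ℕ) = i + 1 ↔ a = i.succ) ∧
      ((a : ℕ) = i + 2 ↔ a = j.succ) := by
    simp [Fin.ext_iff, hij]
  have hj : j.castSucc = i.succ := Fin.ext hij
  rw [← tau_mul_hook hnear, hook_self]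
  refine ext_transfer fun A C => ?_
  rw [transfer_mul, Transfer, lam, rel_ofGraph_le_ker_iff]
  simp only [Sum.forall, lamEdge, Sum.elim_inl, Sum.elim_inr, transfer_tau, val_eq, hj]
  constructor
  · intro h
    refine ⟨fun k => if k = i.castSucc ∨ k = i.succ then A j.succ else A k, ?_⟩
    grind
  · grind

theorem rho_eq_hook {i j : Fin m} (hij : (j : ℕ) = i + 1) : rho (m + 1) i = hook j i := by
  rw [← star_lam, lam_eq_hook hij, star_hook]

end PartitionDiagram

namespace TwoColouredDigraph

variable {V : Type*} {G : TwoColouredDigraph V}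

theorem RBRPath.trans_blue {u v w x : V} (p : G.RBRPath u v) (h : G.blue v w)
    (q : G.RBRPath w x) : G.RBRPath u x := by
  induction p with
  | single hr => exact .cons hr h q
  | cons hr hb _ ih => exact .cons hr hb (ih h)

theorem RBRPath.exists_red_left {u v : V} (p : G.RBRPath u v) : ∃ w, G.red u w := by
  cases p with
  | single h => exact ⟨_, h⟩
  | cons h _ _ => exact ⟨_, h⟩

theorem RBRPath.exists_red_right {u v : V} (p : G.RBRPath u v) : ∃ w, G.red w v := by
  induction p with
  | single h => exact ⟨_, h⟩
  | cons _ _ _ ih => exact ih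

theorem RBRPath.mem_of_invariant {S T : Set V} (hred : ∀ a ∈ S, ∀ b, G.red a b → b ∈ T)
    (hblue : ∀ a ∈ T, ∀ b, G.blue a b → b ∈ S) {u v : V} (p : G.RBRPath u v) (hu : u ∈ S) :
    v ∈ T := by
  induction p with
  | single h => exact hred _ hu _ h
  | cons h h' _ ih => exact ih (hblue _ (hred _ hu _ h) _ h')

theorem IsRBRBase.exists_red_and_red {pos : V → ℤ} (hpos : pos.Injective)
    (hred : ∀ a b, G.red a b → |pos a - pos b| ≤ 1)
    (hblue : ∀ a b, G.blue a b → |pos a - pos b| ≤ 1) {v : V} (h : G.IsRBRBase v) :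
    ∃ w, G.red v w ∧ G.red w v := by
  by_contra! hno
  obtain ⟨x, hx⟩ := RBRPath.exists_red_right h
  obtain ⟨y, hy⟩ := RBRPath.exists_red_left h
  wlog hvy : pos v ≤ pos y generalizing pos
  · refine this (pos := -pos) (neg_injective.comp hpos) (fun a b hab => ?_) (fun a b hab => ?_)
      (neg_le_neg (not_le.1 hvy).le)
    · simpa only [Pi.neg_apply, neg_sub_neg, abs_sub_comm] using hred a b hab
    · simpa only [Pi.neg_apply, neg_sub_neg, abs_sub_comm] using hblue a b hab
  have pos_ne {a b : V} (ha : G.red v a) (hb : G.red b v) : pos a ≠ pos b :=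
    fun he => hno a ha (hpos he ▸ hb)
  have pos_ne_self {a : V} (ha : G.red v a) : pos a ≠ pos v :=
    fun he => hno a ha (hpos he ▸ hpos he ▸ ha)
  have hx_ne : pos x ≠ pos v := fun he => pos_ne_self (hpos he ▸ hx) rfl
  have hy_above : pos y = pos v + 1 := by
    have := abs_le.1 (hred v y hy)
    have := pos_ne_self hy
    omega
  have hx_below : pos x = pos v - 1 := by
    have := abs_le.1 (hred x v hx)
    have := pos_ne hy hx
    omega
  have stays_above : pos v < pos v := by
    refine RBRPath.mem_of_invariant (S := {a | pos v ≤ pos a}) (T := {a | pos v < pos a})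
      (fun a ha b hab => ?_) (fun a ha b hab => ?_) h (le_refl (pos v))
    · simp only [Set.mem_ofPred_eq] at ha ⊢
      have := abs_le.1 (hred a b hab)
      obtain hav | hva := ha.eq_or_lt
      · obtain rfl := hpos hav
        have := pos_ne hab hx
        have := pos_ne_self hab
        omega
      · by_contra! hbv
        obtain rfl : b = v := hpos (by omega)
        exact pos_ne hy hab (by omega)
    · simp only [Set.mem_ofPred_eq] at ha ⊢
      have := abs_le.1 (hblue a b hab)
      omega
  exact lt_irrefl _ stays_above

theorem onRedCircuit_of_red_of_red {v w : V} (hvw : G.red v w) (hwv : G.red w v) :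
    G.OnRedCircuit v :=
  ⟨([v, w] : List V), by simp, by simp [hvw, hwv]⟩

theorem OnRedCircuit.transGen_red {v : V} (h : G.OnRedCircuit v) :
    Relation.TransGen G.red v v := by
  obtain ⟨c, hv, hc⟩ := h
  exact Cycle.chain_iff_pairwise.1 (hc.imp fun _ _ => .single) v hv v hv

theorem rbrPath_of_transGen (hblue : ∀ v, G.blue v v) {u v : V}
    (h : Relation.TransGen G.red u v) : G.RBRPath u v := by
  induction h using Relation.TransGen.head_induction_on with
  | single h => exact .single h
  | head h _ ih => exact .cons h (hblue _) ih

theorem OnRedCircuit.isRBRBase (hblue : ∀ v, G.blue v v) {v : V} (h : G.OnRedCircuit v) :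
    G.IsRBRBase v :=
  rbrPath_of_transGen hblue h.transGen_red

end TwoColouredDigraph

namespace PartitionDiagram

variable {m : ℕ} {F : Set (PartitionDiagram (m + 1))}

theorem hook_mem_subtopIdempotents {i j : Fin m} (hij : Near i j) :
    hook i j ∈ subtopIdempotents (m + 1) :=
  mem_subtopIdempotents_iff.2 ⟨i, j, hij, rfl⟩

theorem tau_mem_subtopIdempotents (i : Fin m) : tau (m + 1) i ∈ subtopIdempotents (m + 1) :=
  hook_self i ▸ hook_mem_subtopIdempotents (.refl i)

theorem tau_inj {i j : Fin m} : tau (m + 1) i = tau (m + 1) j ↔ i = j := by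
  rw [← hook_self, ← hook_self, hook_inj, and_self]

/-- The vertices of `Ξₙ`, indexed as `τ₀, …, τₘ₋₁` for `n = m + 1`. -/
noncomputable def tauVertex : Fin m ≃ XiVertex (m + 1) :=
  Equiv.ofBijective (fun i => ⟨tau (m + 1) i, tau_mem_subtopIdempotents i, star_tau i⟩) <| by
    refine ⟨fun i j h => tau_inj.1 (congrArg Subtype.val h), ?_⟩
    rintro ⟨p, hp, hstar⟩
    obtain ⟨i, j, -, rfl⟩ := mem_subtopIdempotents_iff.1 hp
    obtain ⟨rfl, -⟩ := hook_inj.1 ((star_hook i j).symm.trans hstar)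
    exact ⟨j, Subtype.ext (hook_self j).symm⟩

theorem near_iff {i j : Fin m} :
    Near i j ↔ i = j ∨ (j : ℕ) = i + 1 ∨ (i : ℕ) = j + 1 := by
  unfold Near
  omega

theorem xi_red_iff {i j : Fin m} :
    (Xi (m + 1) F).red (tauVertex i) (tauVertex j) ↔ Near i j ∧ hook i j ∈ F := by
  have eq_of_tau_eq {i : Fin m} {k : ℕ} (hk : k + 1 < m + 1)
      (h : tau (m + 1) i = tau (m + 1) k) : (i : ℕ) = k :=
    congrArg Fin.val ((tau_inj (j := ⟨k, by omega⟩)).1 h)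
  constructor
  · rintro (⟨k, hk, hF, hi, hj⟩ | ⟨k, hk, hF, hi, hj⟩ | ⟨k, hk, hF, hi, hj⟩)
    · obtain rfl : i = k := eq_of_tau_eq hk hi
      obtain rfl : j = i := Fin.ext (eq_of_tau_eq hk hj)
      exact ⟨.refl _, (hook_self _).symm ▸ hF⟩
    · obtain rfl : i = k := eq_of_tau_eq (by omega) hi
      have hij : (j : ℕ) = i + 1 := eq_of_tau_eq hk hj
      exact ⟨near_iff.2 (.inr (.inl hij)), lam_eq_hook hij ▸ hF⟩
    · obtain rfl : j = k := eq_of_tau_eq (by omega) hj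
      have hij : (i : ℕ) = j + 1 := eq_of_tau_eq hk hi
      exact ⟨near_iff.2 (.inr (.inr hij)), rho_eq_hook hij ▸ hF⟩
  · rintro ⟨hij, hF⟩
    obtain rfl | hij | hij := near_iff.1 hij
    · exact .inl ⟨i, by omega, hook_self i ▸ hF, rfl, rfl⟩
    · exact .inr (.inl ⟨i, by omega, lam_eq_hook hij ▸ hF, rfl, hij ▸ rfl⟩)
    · exact .inr (.inr ⟨j, by omega, rho_eq_hook hij ▸ hF, hij ▸ rfl, rfl⟩)

theorem xi_blue_iff {i j : Fin m} :
    (Xi (m + 1) F).blue (tauVertex i) (tauVertex j) ↔ Near i j := by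
  change (tau (m + 1) i * tau (m + 1) j).rank + 2 = m + 1 ↔ _
  rw [← hook_self j]
  refine ⟨fun h => ?_, fun h => by rw [tau_mul_hook h, rank_hook]⟩
  by_contra hij
  exact (rank_tau_mul_hook_lt hij j).ne h

theorem xi_blue_self (v : XiVertex (m + 1)) : (Xi (m + 1) F).blue v v := by
  obtain ⟨i, rfl⟩ := tauVertex.surjective v
  exact xi_blue_iff.2 (.refl i)

theorem hook_mem_closure_of_rbrPath {i j : Fin m}
    (p : (Xi (m + 1) F).RBRPath (tauVertex i) (tauVertex j)) :
    hook i j ∈ Subsemigroup.closure F := by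
  generalize hu : tauVertex i = u, hv : tauVertex j = v at p
  induction p generalizing i with
  | single h =>
    subst hu hv
    exact Subsemigroup.subset_closure (xi_red_iff.1 h).2
  | @cons u w x v h h' _ ih =>
    subst hu
    obtain ⟨k, rfl⟩ := tauVertex.surjective w
    obtain ⟨l, rfl⟩ := tauVertex.surjective x
    rw [← hook_mul_hook i j (xi_blue_iff.1 h')]
    exact mul_mem (Subsemigroup.subset_closure (xi_red_iff.1 h).2) (ih rfl hv)

theorem rank_lt_or_exists_rbrPath (hF : F ⊆ subtopIdempotents (m + 1))
    {α : PartitionDiagram (m + 1)} (hα : α ∈ Subsemigroup.closure F) :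
    α.rank + 2 < m + 1 ∨ ∃ i j, α = hook i j ∧
      (Xi (m + 1) F).RBRPath (tauVertex i) (tauVertex j) := by
  induction hα using Subsemigroup.closure_induction with
  | mem α h =>
    obtain ⟨i, j, hij, rfl⟩ := mem_subtopIdempotents_iff.1 (hF h)
    exact .inr ⟨i, j, rfl, .single (xi_red_iff.2 ⟨hij, h⟩)⟩
  | mul α β _ _ ihα ihβ =>
    obtain hα | ⟨i, j, rfl, p⟩ := ihα
    · exact .inl ((Nat.add_le_add_right (rank_mul_le_left α β) 2).trans_lt hα)
    obtain hβ | ⟨k, l, rfl, q⟩ := ihβ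
    · exact .inl ((Nat.add_le_add_right (rank_mul_le_right _ β) 2).trans_lt hβ)
    by_cases hjk : Near j k
    · exact .inr ⟨i, l, hook_mul_hook i l hjk, p.trans_blue (xi_blue_iff.2 hjk) q⟩
    · exact .inl (rank_hook_mul_hook_lt i l hjk)

theorem hook_mem_closure_iff (hF : F ⊆ subtopIdempotents (m + 1)) {i j : Fin m} :
    hook i j ∈ Subsemigroup.closure F ↔
      (Xi (m + 1) F).RBRPath (tauVertex i) (tauVertex j) := by
  refine ⟨fun h => ?_, hook_mem_closure_of_rbrPath⟩
  obtain hlt | ⟨k, l, hkl, p⟩ := rank_lt_or_exists_rbrPath hF h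
  · exact absurd (rank_hook i j) hlt.ne
  · obtain ⟨rfl, rfl⟩ := hook_inj.1 hkl
    exact p

theorem closure_subset_jones_sdiff_one (hF : F ⊆ subtopIdempotents (m + 1)) :
    (Subsemigroup.closure F : Set (PartitionDiagram (m + 1))) ⊆ jones (m + 1) \ {1} := by
  intro α hα
  constructor
  · have hF_le : Subsemigroup.closure F ≤ (tauClosure m).toSubsemigroup :=
      Subsemigroup.closure_le.2 fun β hβ => (coe_tauClosure (m := m)).ge (hF hβ).1
    exact coe_tauClosure.le (hF_le hα)
  · rintro rfl
    obtain h | ⟨i, j, h, -⟩ := rank_lt_or_exists_rbrPath hF hα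
    · rw [rank_one] at h
      omega
    · have := rank_hook i j
      rw [← h, rank_one] at this
      omega

theorem generatesSingularJones_iff_tau_mem (hF : F ⊆ subtopIdempotents (m + 1)) :
    GeneratesSingularJones F ↔ ∀ i : Fin m, tau (m + 1) i ∈ Subsemigroup.closure F := by
  constructor
  · intro h i
    rw [← SetLike.mem_coe, h]
    refine ⟨tau_mem_jones i, fun h1 => ?_⟩
    have := rank_tau i
    rw [h1, rank_one] at this
    omega
  · intro h
    have htau : Set.range (fun i : Fin m => tau (m + 1) i) ⊆ Subsemigroup.closure F :=
      Set.range_subset_iff.2 h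
    refine (closure_subset_jones_sdiff_one hF).antisymm ?_
    rw [← coe_tauClosure, tauClosure, Submonoid.closure_eq_one_union, Set.sdiff_subset_iff]
    exact Set.union_subset_union_right _ (Subsemigroup.closure_le.2 htau)

theorem generatesSingularJones_iff_isRBRBase (hF : F ⊆ subtopIdempotents (m + 1)) :
    GeneratesSingularJones F ↔ ∀ v, (Xi (m + 1) F).IsRBRBase v := by
  rw [generatesSingularJones_iff_tau_mem hF, ← tauVertex.forall_congr_right]
  exact forall_congr' fun i => by rw [← hook_self, hook_mem_closure_iff hF]; rfl

theorem exists_red_and_red_of_isRBRBase {i : Fin m}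
    (h : (Xi (m + 1) F).IsRBRBase (tauVertex i)) :
    ∃ j, Near i j ∧ hook i j ∈ F ∧ hook j i ∈ F := by
  have pos_sub_le {a b : XiVertex (m + 1)} (hab : Near (tauVertex.symm a) (tauVertex.symm b)) :
      |((tauVertex.symm a : ℕ) : ℤ) - (tauVertex.symm b : ℕ)| ≤ 1 := by
    unfold Near at hab
    rw [abs_le]
    omega
  obtain ⟨w, hvw, hwv⟩ := h.exists_red_and_red (pos := fun v => (tauVertex.symm v : ℕ))
    (fun a b hab => tauVertex.symm.injective (Fin.ext (Int.ofNat.inj hab)))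
    (fun a b hab => pos_sub_le (xi_red_iff.1 (by simpa using hab)).1)
    (fun a b hab => pos_sub_le (xi_blue_iff.1 (by simpa using hab)))
  obtain ⟨j, rfl⟩ := tauVertex.surjective w
  exact ⟨j, (xi_red_iff.1 hvw).1, (xi_red_iff.1 hvw).2, (xi_red_iff.1 hwv).2⟩

theorem onRedCircuit_tauVertex {i j : Fin m} (hij : Near i j) (hF : hook i j ∈ F)
    (hF' : hook j i ∈ F) : (Xi (m + 1) F).OnRedCircuit (tauVertex i) :=
  TwoColouredDigraph.onRedCircuit_of_red_of_red (xi_red_iff.2 ⟨hij, hF⟩)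
    (xi_red_iff.2 ⟨hij.symm, hF'⟩)

theorem generatesSingularJones_tfae (hF : F ⊆ subtopIdempotents (m + 1)) :
    List.TFAE [
      GeneratesSingularJones F,
      ∀ v, (Xi (m + 1) F).IsRBRBase v,
      ∀ i : Fin m, ∃ j, Near i j ∧ hook i j ∈ F ∧ hook j i ∈ F,
      ∀ v, (Xi (m + 1) F).OnRedCircuit v] := by
  tfae_have 1 ↔ 2 := generatesSingularJones_iff_isRBRBase hF
  tfae_have 2 → 3 := fun h i => exists_red_and_red_of_isRBRBase (h (tauVertex i))
  tfae_have 3 → 4 := fun h => tauVertex.forall_congr_right.1 fun i =>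
    have ⟨_, hij, hF, hF'⟩ := h i
    onRedCircuit_tauVertex hij hF hF'
  tfae_have 4 → 2 := fun h v => (h v).isRBRBase xi_blue_self
  tfae_finish

end PartitionDiagram

/-- Loops `l` and pairs `e` of opposite arcs, placed on the vertices and edges of a path, cover
every vertex: it has a loop, lies on an edge with both arcs, or is the first vertex and `t` holds.
The flag `t` stands for an edge with both arcs before the first vertex. -/
def Covers {m : ℕ} (t : Bool) (l : Fin (m + 1) → Bool) (e : Fin m → Bool × Bool) : Prop :=
  ∀ i, l i ∨ (i = 0 ∧ t) ∨ ∃ k, ((e k).1 && (e k).2) ∧ (i = k.castSucc ∨ i = k.succ)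

instance {m : ℕ} (t : Bool) (l : Fin (m + 1) → Bool) (e : Fin m → Bool × Bool) :
    Decidable (Covers t l e) := by
  unfold Covers
  infer_instance

theorem covers_cons {m : ℕ} {t a : Bool} {d : Bool × Bool} {l : Fin (m + 1) → Bool}
    {e : Fin m → Bool × Bool} :
    Covers t (Fin.cons a l) (Fin.cons d e) ↔
      (a || t || (d.1 && d.2)) ∧ Covers (d.1 && d.2) l e := by
  unfold Covers
  rw [Fin.forall_fin_succ]
  refine and_congr ?_ (forall_congr' fun i => ?_)
  · simp only [Fin.cons_zero, Fin.exists_fin_succ, Fin.cons_succ, Fin.castSucc_zero,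
      ← Fin.succ_castSucc, (Fin.succ_ne_zero _).symm, Bool.or_eq_true]
    tauto
  · simp only [Fin.cons_zero, Fin.exists_fin_succ, Fin.cons_succ, Fin.castSucc_zero,
      Fin.succ_ne_zero, ← Fin.succ_castSucc, Fin.succ_inj, false_and, false_or,
      and_comm (a := i = 0)]

/-- The number of configurations that cover a path with `m` edges. -/
def coverCount (m : ℕ) (t : Bool) : ℕ :=
  Fintype.card {p : (Fin (m + 1) → Bool) × (Fin m → Bool × Bool) // Covers t p.1 p.2}

theorem coverCount_succ (m : ℕ) (t : Bool) :
    coverCount (m + 1) t = ∑ p : Bool × Bool × Bool,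
      if p.1 || t || (p.2.1 && p.2.2) then coverCount m (p.2.1 && p.2.2) else 0 := by
  let split := (Equiv.prodProdProdComm Bool (Bool × Bool) (Fin (m + 1) → Bool)
    (Fin m → Bool × Bool)).trans ((Fin.consEquiv fun _ => Bool).prodCongr
      (Fin.consEquiv fun _ => Bool × Bool))
  simp only [coverCount, Fintype.card_subtype, Finset.card_filter]
  rw [← split.sum_comp, Fintype.sum_prod_type]
  refine Finset.sum_congr rfl fun p _ => ?_
  split_ifs with h
  · refine Finset.sum_congr rfl fun c _ => if_congr ?_ rfl rfl
    exact covers_cons.trans (and_iff_right h)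
  · exact Finset.sum_eq_zero fun c _ => if_neg fun hc => h (covers_cons.1 hc).1

theorem coverCount_succ_false (m : ℕ) :
    coverCount (m + 1) false = 2 * coverCount m true + 3 * coverCount m false := by
  simp only [coverCount_succ, Fintype.sum_prod_type, Fintype.sum_bool, Bool.true_and,
    Bool.false_and, Bool.or_false, Bool.false_or, Bool.true_or, Bool.false_eq_true, ↓reduceIte]
  ring

theorem coverCount_succ_true (m : ℕ) :
    coverCount (m + 1) true = 2 * coverCount m true + 6 * coverCount m false := by
  simp only [coverCount_succ, Fintype.sum_prod_type, Fintype.sum_bool, Bool.true_and,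
    Bool.false_and, Bool.or_true, Bool.true_or, ↓reduceIte]
  ring

theorem coverCount_add_two (m : ℕ) :
    coverCount (m + 2) false = 5 * coverCount (m + 1) false + 6 * coverCount m false := by
  simp only [coverCount_succ_false, coverCount_succ_true]
  ring

namespace PartitionDiagram

variable {m : ℕ}

/-- The set of idempotents whose red arcs in `Ξₙ` are the given loops `l` and edge arcs `e`. -/
def arcSet (l : Fin (m + 1) → Bool) (e : Fin m → Bool × Bool) :
    Set (PartitionDiagram (m + 1 + 1)) :=
  {α | (∃ i, l i ∧ α = hook i i) ∨ (∃ k, (e k).1 ∧ α = hook k.castSucc k.succ) ∨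
    ∃ k, (e k).2 ∧ α = hook k.succ k.castSucc}

theorem near_castSucc_succ (k : Fin m) : Near k.castSucc k.succ :=
  near_iff.2 (.inr (.inl rfl))

theorem Near.eq_or_castSucc_succ {i j : Fin (m + 1)} (hij : Near i j) :
    i = j ∨ (∃ k : Fin m, k.castSucc = i ∧ k.succ = j) ∨
      ∃ k : Fin m, k.succ = i ∧ k.castSucc = j := by
  obtain hij | hij | hij := near_iff.1 hij
  · exact .inl hij
  · exact .inr (.inl ⟨⟨i, by omega⟩, rfl, Fin.ext hij.symm⟩)
  · exact .inr (.inr ⟨⟨j, by omega⟩, Fin.ext hij.symm, rfl⟩)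

variable {l : Fin (m + 1) → Bool} {e : Fin m → Bool × Bool}

theorem hook_self_mem_arcSet {i : Fin (m + 1)} : hook i i ∈ arcSet l e ↔ l i := by
  simp only [arcSet, Set.mem_ofPred_eq, hook_inj, Fin.ext_iff, Fin.val_succ, Fin.val_castSucc]
  grind

theorem hook_castSucc_succ_mem_arcSet {k : Fin m} :
    hook k.castSucc k.succ ∈ arcSet l e ↔ (e k).1 := by
  simp only [arcSet, Set.mem_ofPred_eq, hook_inj, Fin.ext_iff, Fin.val_succ, Fin.val_castSucc]
  grind

theorem hook_succ_castSucc_mem_arcSet {k : Fin m} :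
    hook k.succ k.castSucc ∈ arcSet l e ↔ (e k).2 := by
  simp only [arcSet, Set.mem_ofPred_eq, hook_inj, Fin.ext_iff, Fin.val_succ, Fin.val_castSucc]
  grind

theorem arcSet_subset : arcSet l e ⊆ subtopIdempotents (m + 1 + 1) := by
  rintro α (⟨i, -, rfl⟩ | ⟨k, -, rfl⟩ | ⟨k, -, rfl⟩)
  · exact hook_mem_subtopIdempotents (.refl i)
  · exact hook_mem_subtopIdempotents (near_castSucc_succ k)
  · exact hook_mem_subtopIdempotents (near_castSucc_succ k).symm

theorem covers_iff_forall_exists_near : Covers false l e ↔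
    ∀ i, ∃ j, Near i j ∧ hook i j ∈ arcSet l e ∧ hook j i ∈ arcSet l e := by
  refine forall_congr' fun i => ⟨?_, ?_⟩
  · rintro (h | h | ⟨k, h, rfl | rfl⟩)
    · exact ⟨i, .refl i, hook_self_mem_arcSet.2 h, hook_self_mem_arcSet.2 h⟩
    · exact absurd h.2 Bool.false_ne_true
    all_goals rw [Bool.and_eq_true] at h
    · exact ⟨k.succ, near_castSucc_succ k, hook_castSucc_succ_mem_arcSet.2 h.1,
        hook_succ_castSucc_mem_arcSet.2 h.2⟩
    · exact ⟨k.castSucc, (near_castSucc_succ k).symm, hook_succ_castSucc_mem_arcSet.2 h.2,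
        hook_castSucc_succ_mem_arcSet.2 h.1⟩
  · rintro ⟨j, hij, hF, hF'⟩
    obtain rfl | ⟨k, rfl, rfl⟩ | ⟨k, rfl, rfl⟩ := hij.eq_or_castSucc_succ
    · exact .inl (hook_self_mem_arcSet.1 hF)
    · rw [hook_castSucc_succ_mem_arcSet] at hF
      rw [hook_succ_castSucc_mem_arcSet] at hF'
      exact .inr (.inr ⟨k, Bool.and_eq_true _ _ ▸ ⟨hF, hF'⟩, .inl rfl⟩)
    · rw [hook_succ_castSucc_mem_arcSet] at hF
      rw [hook_castSucc_succ_mem_arcSet] at hF'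
      exact .inr (.inr ⟨k, Bool.and_eq_true _ _ ▸ ⟨hF', hF⟩, .inr rfl⟩)

theorem covers_arcSet : Covers false l e ↔ GeneratesSingularJones (arcSet l e) :=
  covers_iff_forall_exists_near.trans
    ((generatesSingularJones_tfae arcSet_subset).out 2 0 :)

theorem exists_arcSet_eq {F : Set (PartitionDiagram (m + 1 + 1))}
    (hF : F ⊆ subtopIdempotents (m + 1 + 1)) : ∃ l e, arcSet l e = F := by
  classical
  refine ⟨fun i => decide (hook i i ∈ F), fun k =>
    (decide (hook k.castSucc k.succ ∈ F), decide (hook k.succ k.castSucc ∈ F)), ?_⟩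
  have mem_iff {i j : Fin (m + 1)} (hij : Near i j) :
      hook i j ∈ arcSet (fun i => decide (hook i i ∈ F)) (fun k =>
        (decide (hook k.castSucc k.succ ∈ F), decide (hook k.succ k.castSucc ∈ F))) ↔
        hook i j ∈ F := by
    obtain rfl | ⟨k, rfl, rfl⟩ | ⟨k, rfl, rfl⟩ := hij.eq_or_castSucc_succ
    · rw [hook_self_mem_arcSet, decide_eq_true_iff]
    · rw [hook_castSucc_succ_mem_arcSet, decide_eq_true_iff]
    · rw [hook_succ_castSucc_mem_arcSet, decide_eq_true_iff]
  ext α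
  by_cases hα : α ∈ subtopIdempotents (m + 1 + 1)
  · obtain ⟨i, j, hij, rfl⟩ := mem_subtopIdempotents_iff.1 hα
    exact mem_iff hij
  · exact iff_of_false (fun h => hα (arcSet_subset h)) fun h => hα (hF h)

theorem arcSet_injective : (Function.uncurry (arcSet (m := m))).Injective := by
  rintro ⟨l, e⟩ ⟨l', e'⟩ h
  refine Prod.ext (funext fun i => ?_) (funext fun k => Prod.ext ?_ ?_) <;>
    rw [Bool.eq_iff_iff]
  · exact hook_self_mem_arcSet.symm.trans <| (Set.ext_iff.1 h _).trans hook_self_mem_arcSet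
  · exact hook_castSucc_succ_mem_arcSet.symm.trans <|
      (Set.ext_iff.1 h _).trans hook_castSucc_succ_mem_arcSet
  · exact hook_succ_castSucc_mem_arcSet.symm.trans <|
      (Set.ext_iff.1 h _).trans hook_succ_castSucc_mem_arcSet

theorem numGeneratingSets_add_two (m : ℕ) : numGeneratingSets (m + 2) = coverCount m false := by
  have image_eq : {F : Set (PartitionDiagram (m + 1 + 1)) | F ⊆ subtopIdempotents (m + 1 + 1) ∧
      GeneratesSingularJones F} =
        Function.uncurry arcSet '' {p : (Fin (m + 1) → Bool) × _ | Covers false p.1 p.2} := by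
    ext F
    constructor
    · rintro ⟨hF, hgen⟩
      obtain ⟨l, e, rfl⟩ := exists_arcSet_eq hF
      exact ⟨(l, e), covers_arcSet.2 hgen, rfl⟩
    · rintro ⟨⟨l, e⟩, hcov, rfl⟩
      exact ⟨arcSet_subset, covers_arcSet.1 hcov⟩
  rw [numGeneratingSets, image_eq, Set.ncard_image_of_injective _ arcSet_injective,
    ← Nat.card_coe_set_eq, coverCount, Nat.card_eq_fintype_card]
  rfl

end PartitionDiagram

theorem mainTheorem6 :
    (∀ n : ℕ, 1 ≤ n → ∀ F : Set (PartitionDiagram n),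
      F ⊆ PartitionDiagram.subtopIdempotents n →
        List.TFAE [
          PartitionDiagram.GeneratesSingularJones F,
          ∀ v : PartitionDiagram.XiVertex n, (PartitionDiagram.Xi n F).IsRBRBase v,
          ∀ v : PartitionDiagram.XiVertex n, (PartitionDiagram.Xi n F).OnRedCircuit v]) ∧
    PartitionDiagram.numGeneratingSets 2 = 1 ∧
    PartitionDiagram.numGeneratingSets 3 = 7 ∧
    ∀ n : ℕ, 4 ≤ n →
      PartitionDiagram.numGeneratingSets n =
        5 * PartitionDiagram.numGeneratingSets (n - 1) +
          6 * PartitionDiagram.numGeneratingSets (n - 2) := by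
  have count_zero : coverCount 0 false = 1 := by decide
  refine ⟨fun n hn F hF => ?_, ?_, ?_, fun n hn => ?_⟩
  · obtain ⟨m, rfl⟩ := Nat.exists_eq_add_of_le' hn
    have tfae := PartitionDiagram.generatesSingularJones_tfae hF
    tfae_have 1 ↔ 2 := tfae.out 0 1
    tfae_have 1 ↔ 3 := tfae.out 0 3
    tfae_finish
  · rw [PartitionDiagram.numGeneratingSets_add_two 0, count_zero]
  · have count_one : coverCount 1 false = 7 := by decide
    rw [PartitionDiagram.numGeneratingSets_add_two 1, count_one]
  · obtain ⟨m, rfl⟩ := Nat.exists_eq_add_of_le' hn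
    rw [show m + 4 - 1 = m + 1 + 2 by omega, show m + 4 - 2 = m + 2 by omega]
    simp only [PartitionDiagram.numGeneratingSets_add_two]
    exact coverCount_add_two m
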